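/- Let $d\in\mathbb N=\{1,2,\dots\}$, $r\in\mathbb N_0$, $1\le p\le 2$, and let $X$ be a (real or complex) Banach space. Let $Q=[0,1]^d$, let $B$ be the closed unit ball of the space $C^r(Q,X)$ of $r$-times continuously differentiable functions $f:Q\to X$ with norm $\max_{0\le|\alpha|\le r,\,t\in Q}\|D^\alpha f(t)\|$, and let $S^Xf=\int_Q f(t)\,dt$. The space $X$ is of equal norm type $p$ if there is a constant $c>0$ such that for all $n\in\mathbb N$ and all $x_1,\dots,x_n\in X$ with $\|x_1\|=\dots=\|x_n\|$ $$\Big(\mathbb E\Big\|\sum_{i=1}^n\varepsilon_ix_i\Big\|^p\Big)^{1/p}\le c\Big(\sum_{i=1}^n\|x_i\|^p\Big)^{1/p},$$ where $\varepsilon_1,\dots,\varepsilon_n$ are independent with $\mathbb P\{\varepsilon_i=1\}=\mathbb P\{\varepsilon_i=-1\}=1/2$. A deterministic adaptive algorithm $A$ consists of arbitrary maps $L_i:X^{i-1}\to Q$ $(i\ge1)$, $\rho_i:X^i\to\{0,1\}$ and $\varphi_i:X^i\to X$ $(i\ge0)$, where $X^0$ is a one-point set. For an input $f$ put $t_i=L_i(f(t_1),\dots,f(t_{i-1}))$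 for $i\ge1$; the cardinality $\mathrm{card}(A,f)$ is the least $n\ge0$ with $\rho_n(f(t_1),\dots,f(t_n))=1$, or $+\infty$ if there is none, and if it is a finite number $n$, the output is $Af=\varphi_n(f(t_1),\dots,f(t_n))$. For $n\in\mathbb N$, a randomized algorithm using on the average at most $n$ function values is a probability space $(\Omega,\Sigma,\mathbb P)$ with a family $(A_\omega)_{\omega\in\Omega}$ of deterministic adaptive algorithms such that for every $f\in B$ the map $\omega\mapsto\mathrm{card}(A_\omega,f)$ is $\Sigma$-measurable with $\mathbb E\,\mathrm{card}(A_\omega,f)\le n$, and the map $\omega\mapsto A_\omega f$ (set to $0$ on the null set where $\mathrm{card}(A_\omega,f)=\infty$) is $\Sigma$-to-Borel measurable and almost surely takes values in a separable subspace of $X$ (which may depend on $f$). The randomized $n$-th minimal error $e_n^{\mathrm{ran}}(S^X,B_{C^r(Q,X)})$ is the infimum of $\sup_{f\in B}\mathbb E\|S^Xf-A_\omega f\|$ over all such randomized algorithms. Then the following are equivalent: (i) $X$ is of equal norm type $p$. (ii) There is a constant $c>0$ such that for all $n\in\mathbb N$ $$e_n^{\mathrm{ran}}(S^X,B_{C^r(Q,X)})\le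 c\,n^{-r/d-1+1/p}.$$ -/

import Mathlib

open MeasureTheory
open scoped ENNReal

universe u v

namespace BanachIntegration

/-- The closed unit cube `Q = [0,1]^d`. -/
def cube (d : ℕ) : Set (Fin d → ℝ) := Set.Icc 0 1

/-- The mixed partial derivative `∂_{i 0} ⋯ ∂_{i (k-1)} f (t)` of order `k`, relative to the cube.
It is `D^α f (t)` for the multi-index `α` with `α l = #{j | i j = l}`; every multi-index with
`|α| = k` is obtained from such a sequence `i` of coordinates. At boundary points the derivative is
the one relative to the cube. -/
noncomputable def partialDeriv {d : ℕ} {X : Type u} [NormedAddCommGroup X] [NormedSpace ℝ X]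
    {k : ℕ} (i : Fin k → Fin d) (f : (Fin d → ℝ) → X) (t : Fin d → ℝ) : X :=
  iteratedFDerivWithin ℝ k f (cube d) t (fun j => Pi.single (i j) 1)

/-- The norm of `C^r(Q, X)`: the maximum over `|α| ≤ r` and `t ∈ Q` of `‖D^α f (t)‖`. -/
noncomputable def crNorm {d : ℕ} {X : Type u} [NormedAddCommGroup X] [NormedSpace ℝ X]
    (r : ℕ) (f : (Fin d → ℝ) → X) : ℝ≥0∞ :=
  ⨆ (k : ℕ) (_ : k ≤ r) (i : Fin k → Fin d) (t : Fin d → ℝ) (_ : t ∈ cube d),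
    ‖partialDeriv i f t‖ₑ

/-- The closed unit ball of `C^r(Q, X)`. A function on `Q` is represented by a function on `ℝ^d`
of which only the restriction to `Q` matters. -/
def crBall (d : ℕ) (X : Type u) [NormedAddCommGroup X] [NormedSpace ℝ X] (r : ℕ) :
    Set ((Fin d → ℝ) → X) :=
  {f | ContDiffOn ℝ r f (cube d) ∧ crNorm r f ≤ 1}

/-- The integration operator `S f = ∫_Q f(t) dt`. -/
noncomputable def integralOp {d : ℕ} {X : Type u} [NormedAddCommGroup X] [NormedSpace ℝ X]
    (f : (Fin d → ℝ) → X) : X :=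
  ∫ t in cube d, f t

/-- A deterministic adaptive algorithm of varying cardinality. After the values
`f(t_1), …, f(t_i)` are known, `halt i` tells whether to stop, `output i` is the result if the
algorithm stops now, and `node i` is the next node `t_{i+1}` otherwise. For `i = 0` the argument is
the empty tuple, so that these are constants. All maps are arbitrary. -/
structure DetAlg (d : ℕ) (X : Type u) where
  /-- choice of the next node -/
  node : (i : ℕ) → (Fin i → X) → cube d
  /-- stopping rule -/
  halt : (i : ℕ) → (Fin i → X) → Bool
  /-- output -/
  output : (i : ℕ) → (Fin i → X) → X

namespace DetAlg

variable {d : ℕ} {X : Type u}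

/-- The information `(f(t_1), …, f(t_n))` collected on input `f` in the first `n` steps. -/
def values (A : DetAlg d X) (f : (Fin d → ℝ) → X) : (n : ℕ) → (Fin n → X)
  | 0 => Fin.elim0
  | n + 1 => Fin.snoc (α := fun _ => X) (values A f n) (f (A.node n (values A f n)))

/-- The algorithm stops on input `f` after finitely many steps. -/
def Halts (A : DetAlg d X) (f : (Fin d → ℝ) → X) : Prop :=
  ∃ n : ℕ, A.halt n (A.values f n) = true

open Classical in
/-- The cardinality of `A` at input `f`: the number of function values used until the algorithm
stops, `⊤` if it does not stop. -/
noncomputable def card (A : DetAlg d X) (f : (Fin d → ℝ) → X) : ℕ∞ :=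
  if h : A.Halts f then ((Nat.find h : ℕ) : ℕ∞) else ⊤

open Classical in
/-- The output of `A` at input `f` (set to `0` where the algorithm does not stop). -/
noncomputable def result [Zero X] (A : DetAlg d X) (f : (Fin d → ℝ) → X) : X :=
  if h : A.Halts f then A.output (Nat.find h) (A.values f (Nat.find h)) else 0

end DetAlg

/-- The family `(A ω)` over the probability space `(Ω, P)` is a randomized algorithm on the unit
ball of `C^r(Q, X)` that uses at most `n` function values on the average: for each input `f` the
cardinality is measurable with expectation at most `n`, and the output is Borel measurable and
almost surely in a separable subspace. -/
structure IsRandAlg {d : ℕ} {X : Type u} [NormedAddCommGroup X] [NormedSpace ℝ X] (r n : ℕ)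
    {Ω : Type v} [MeasurableSpace Ω] (P : Measure Ω) (A : Ω → DetAlg d X) : Prop where
  prob : IsProbabilityMeasure P
  measurable_card : ∀ f ∈ crBall d X r, Measurable (fun ω => (A ω).card f)
  card_le : ∀ f ∈ crBall d X r, ∫⁻ ω, (((A ω).card f : ℕ∞) : ℝ≥0∞) ∂P ≤ n
  measurable_result : ∀ f ∈ crBall d X r,
    @Measurable Ω X _ (borel X) (fun ω => (A ω).result f)
  separable_result : ∀ f ∈ crBall d X r, ∃ X₀ : Submodule ℝ X,
    TopologicalSpace.IsSeparable (X₀ : Set X) ∧ ∀ᵐ ω ∂P, (A ω).result f ∈ X₀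

/-- The error `sup_f E ‖S f - A_ω f‖` of a randomized algorithm on the unit ball of `C^r(Q, X)`. -/
noncomputable def randError {d : ℕ} {X : Type u} [NormedAddCommGroup X] [NormedSpace ℝ X] (r : ℕ)
    {Ω : Type v} [MeasurableSpace Ω] (P : Measure Ω) (A : Ω → DetAlg d X) : ℝ≥0∞ :=
  ⨆ f ∈ crBall d X r, ∫⁻ ω, ‖integralOp f - (A ω).result f‖ₑ ∂P

/-- The randomized `n`-th minimal error `e_n^ran(S^X, B_{C^r(Q,X)})`, the infimum over all
randomized algorithms, on all probability spaces of the universe `v`. -/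
noncomputable def ranMinError (d : ℕ) (X : Type u) [NormedAddCommGroup X] [NormedSpace ℝ X]
    (r n : ℕ) : ℝ≥0∞ :=
  ⨅ (Ω : Type v) (_ : MeasurableSpace Ω) (P : Measure Ω) (A : Ω → DetAlg d X)
    (_ : IsRandAlg r n P A), randError r P A

/-- `E ‖∑ ε_i x_i‖^p` for independent random signs `ε_i`, that is, for `(ε_i)` uniformly
distributed on `{-1, 1}^n`. -/
noncomputable def rademacherMoment {X : Type u} [NormedAddCommGroup X] (p : ℝ) {n : ℕ}
    (x : Fin n → X) : ℝ :=
  (∑ ε : Fin n → ℤˣ, ‖∑ i, ((ε i : ℤˣ) : ℤ) • x i‖ ^ p) / 2 ^ n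

/-- `X` is of equal norm type `p`: for some `c > 0` and all `n`, the type `p` inequality with
constant `c` holds for all `n`-tuples of vectors of equal norm. -/
def IsEqualNormType (X : Type u) [NormedAddCommGroup X] (p : ℝ) : Prop :=
  ∃ c : ℝ, 0 < c ∧ ∀ n : ℕ, 1 ≤ n → ∀ x : Fin n → X, (∀ i j, ‖x i‖ = ‖x j‖) →
    rademacherMoment p x ^ (1 / p) ≤ c * (∑ i, ‖x i‖ ^ p) ^ (1 / p)

end BanachIntegration

/-!
Both implications compare the minimal errors with the first moments `E ‖∑ ε_i x_i‖` of signed sums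
of `n` vectors of the unit ball of `X`. Equal norm type `p` means that these Rademacher averages
(`radMean`) are of order `n^{1/p}`. One direction of this equivalence is the contraction principle
(`IsEqualNormType.radMean_le`). The other (`isEqualNormType_of_radMean_le`) has to pass from the
first to the `p`-th moment; Kahane's inequality is not needed for this, since by the Efron–Stein
inequality the variance is at most `n`, and `n ≤ n^{2/p}`.

*Upper bound.* Piecewise polynomial interpolation on `k^d` subcubes uses a multiple of `k^d` function
values and approximates every function of the unit ball of `C^r` up to `C k^{-r}`
(`exists_interpolation_cube`): one-dimensional Lagrange interpolation is compared with the Taylor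
polynomial and then applied in one variable after the other, so that only pure derivatives enter.
The algorithm integrates the interpolant exactly and the remainder by the Monte Carlo method with
`k^d` samples. By symmetrization (`integral_norm_sum_sub_le`), the error of the latter is at most
`2 k^{-d}` times a Rademacher average of `k^d` vectors of norm at most `C k^{-r}`, which is the
claimed rate.

*Lower bound.* Bumps with disjoint supports in `N` subcubes of volume about `1 / N` give functions
`f_ε` in the unit ball whose integrals are `γ ∑ ε_i x_i` with `γ` of order `N^{-r/d-1}`. An adaptive
algorithm that has used at most `N / 2` function values knows a set `J` of at most `N / 2` signs, and
the set `J` depends on these signs only. Exchanging the signs off `J` with those of an independent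
copy preserves the measure and the information of the algorithm, so that its error is on average at
least `γ E ‖∑_{i ∉ J} ε_i x_i‖` (`card_mul_le_sum_norm`). Hence the average over all `N` vectors
exceeds the one over some `J` by at most `2 γ⁻¹` times the error (`radMean_sub_le_randError`). If the
errors have the rate of the theorem, this excess is of order `N^{1/p}`, and iterating from `N` to
`N / 2` leads to a geometric series (`radMean_le_of_ranMinError_le`).
-/

open scoped BigOperators

namespace BanachIntegration

/-! ### Rademacher averages -/

section Rademacher

variable {X : Type u} [NormedAddCommGroup X] {ι : Type*} [Fintype ι] [DecidableEq ι]

/-- The signed sum `∑ ε_i x_i`. -/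
def radSum (ε : ι → ℤˣ) (x : ι → X) : X := ∑ i, ((ε i : ℤˣ) : ℤ) • x i

/-- The Rademacher average `E ‖∑ ε_i x_i‖`. -/
noncomputable def radMean (x : ι → X) : ℝ := 𝔼 ε : ι → ℤˣ, ‖radSum ε x‖

lemma norm_units_smul (s : ℤˣ) (x : X) : ‖((s : ℤˣ) : ℤ) • x‖ = ‖x‖ := by
  rcases Int.units_eq_one_or s with h | h <;> simp [h]

omit [DecidableEq ι] in
lemma norm_radSum_le (ε : ι → ℤˣ) (x : ι → X) : ‖radSum ε x‖ ≤ ∑ i, ‖x i‖ :=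
  (norm_sum_le _ _).trans_eq (by simp only [norm_units_smul])

lemma radMean_nonneg (x : ι → X) : 0 ≤ radMean x :=
  Finset.expect_nonneg fun _ _ => norm_nonneg _

lemma radMean_le_sum (x : ι → X) : radMean x ≤ ∑ i, ‖x i‖ :=
  Finset.expect_le Finset.univ_nonempty fun ε _ => norm_radSum_le ε x

lemma radMean_le_card (x : ι → X) (hx : ∀ i, ‖x i‖ ≤ 1) : radMean x ≤ Fintype.card ι :=
  (radMean_le_sum x).trans ((Finset.sum_le_card_nsmul _ _ 1 fun i _ => hx i).trans (by simp))

/-- Signs of indices outside `J` do not matter for the average of a signed sum over `J`. -/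
lemma expect_norm_sum_finset (J : Finset ι) (x : ι → X) :
    𝔼 ε : ι → ℤˣ, ‖∑ i ∈ J, ((ε i : ℤˣ) : ℤ) • x i‖ = radMean (fun i : J => x i) := by
  classical
  have h := Fintype.expect_equiv (Equiv.piEquivPiSubtypeProd (· ∈ J) (fun _ : ι => ℤˣ))
    (fun ε => ‖∑ i ∈ J, ((ε i : ℤˣ) : ℤ) • x i‖)
    (fun q => ‖radSum q.1 (fun i : J => x i)‖) (by
      intro ε
      simp only [radSum, Equiv.piEquivPiSubtypeProd_apply]
      rw [← Finset.sum_coe_sort])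
  rw [h, ← Finset.univ_product_univ,
    Finset.expect_product' _ _ (fun a _ => ‖radSum a (fun i : J => x i)‖)]
  simp only [Finset.expect_const Finset.univ_nonempty]
  unfold radMean
  congr!

/-- Averages over sign patterns are invariant under multiplication by a fixed pattern. -/
lemma expect_mul_left (η : ι → ℤˣ) (F : (ι → ℤˣ) → ℝ) :
    𝔼 ε : ι → ℤˣ, F (η * ε) = 𝔼 ε : ι → ℤˣ, F ε :=
  Fintype.expect_equiv (Equiv.mulLeft η) _ _ fun _ => rfl

lemma radMean_mul_signs (η : ι → ℤˣ) (x : ι → X) :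
    radMean (fun i => ((η i : ℤˣ) : ℤ) • x i) = radMean x := by
  rw [radMean]
  refine (Finset.expect_congr rfl fun ε _ => ?_).trans
    (expect_mul_left η fun ε => ‖radSum ε x‖)
  simp only [radSum, Pi.mul_apply, Units.val_mul, smul_smul, mul_comm]

variable [NormedSpace ℝ X]

lemma radMean_smul (a : ℝ) (x : ι → X) : radMean (fun i => a • x i) = |a| * radMean x := by
  rw [radMean, radMean, Finset.mul_expect]
  refine Finset.expect_congr rfl fun ε _ => ?_
  rw [← Real.norm_eq_abs, ← norm_smul]
  simp only [radSum, Finset.smul_sum]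
  congr 1
  exact Finset.sum_congr rfl fun i _ => smul_comm _ _ _

/-- Convexity of the Rademacher average. -/
lemma radMean_convex {a b : ℝ} (ha : 0 ≤ a) (hb : 0 ≤ b) (x y : ι → X) :
    radMean (fun i => a • x i + b • y i) ≤ a * radMean x + b * radMean y := by
  rw [radMean, radMean, radMean, Finset.mul_expect, Finset.mul_expect, ← Finset.expect_add_distrib]
  refine Finset.expect_le_expect fun ε _ => ?_
  have : radSum ε (fun i => a • x i + b • y i) = a • radSum ε x + b • radSum ε y := by
    simp only [radSum, Finset.smul_sum, ← Finset.sum_add_distrib, smul_add]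
    refine Finset.sum_congr rfl fun i _ => ?_
    rw [smul_comm _ a, smul_comm _ b]
  rw [this]
  refine (norm_add_le _ _).trans_eq ?_
  rw [norm_smul, norm_smul, Real.norm_of_nonneg ha, Real.norm_of_nonneg hb]

/-- One step of the contraction principle: shrinking one vector does not increase the average,
because it is a convex combination of that vector and its negative. -/
lemma radMean_update_le (x : ι → X) (i : ι) {l : ℝ} (h0 : 0 ≤ l) (h1 : l ≤ 1) :
    radMean (Function.update x i (l • x i)) ≤ radMean x := by
  have hneg : radMean (Function.update x i (-x i)) = radMean x := by
    rw [← radMean_mul_signs (Function.update 1 i (-1)) x]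
    congr 1
    ext j
    by_cases h : j = i
    · subst h; simp
    · simp [Function.update_of_ne h]
  have hc := radMean_convex (a := (1 + l) / 2) (b := (1 - l) / 2) (by linarith) (by linarith)
    x (Function.update x i (-x i))
  rw [hneg] at hc
  refine le_trans (le_of_eq ?_) (hc.trans_eq (by ring))
  congr 1
  ext j
  by_cases h : j = i
  · subst h
    simp only [Function.update_self]
    rw [smul_neg, ← sub_eq_add_neg, ← sub_smul]
    congr 1; ring
  · simp only [Function.update_of_ne h]
    rw [← add_smul]
    have : (1 + l) / 2 + (1 - l) / 2 = 1 := by ring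
    rw [this, one_smul]

/-- The contraction principle for multipliers in `[0, 1]`. -/
lemma radMean_contraction (x : ι → X) (l : ι → ℝ) (h0 : ∀ i, 0 ≤ l i) (h1 : ∀ i, l i ≤ 1) :
    radMean (fun i => l i • x i) ≤ radMean x := by
  classical
  have key : ∀ S : Finset ι, radMean (fun i => if i ∈ S then l i • x i else x i) ≤ radMean x := by
    intro S
    induction S using Finset.induction_on with
    | empty => simp
    | insert a S ha ih =>
      refine le_trans (le_of_eq ?_) ((radMean_update_le
        (fun i => if i ∈ S then l i • x i else x i) a (h0 a) (h1 a)).trans ih)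
      congr 1
      ext j
      by_cases h : j = a
      · subst h; simp [ha]
      · simp [h]
  simpa using key Finset.univ

end Rademacher

section EqualNorm

variable {X : Type u} [NormedAddCommGroup X]

lemma rademacherMoment_eq_expect (p : ℝ) {n : ℕ} (x : Fin n → X) :
    rademacherMoment p x = 𝔼 ε : Fin n → ℤˣ, ‖radSum ε x‖ ^ p := by
  rw [rademacherMoment, Fintype.expect_eq_sum_div_card]
  simp [radSum, Fintype.card_pi]

lemma rademacherMoment_nonneg (p : ℝ) {n : ℕ} (x : Fin n → X) : 0 ≤ rademacherMoment p x := by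
  rw [rademacherMoment_eq_expect]
  exact Finset.expect_nonneg fun _ _ => Real.rpow_nonneg (norm_nonneg _) _

/-- Jensen's inequality for powers of a nonnegative function of random signs. -/
lemma expect_rpow_le {ι : Type*} [Fintype ι] [Nonempty ι] {q : ℝ} (hq : 1 ≤ q) (F : ι → ℝ)
    (hF : ∀ i, 0 ≤ F i) : (𝔼 i, F i) ^ q ≤ 𝔼 i, F i ^ q := by
  have h := Real.rpow_arith_mean_le_arith_mean_rpow Finset.univ
    (fun _ : ι => (1 / Fintype.card ι : ℝ)) F (fun _ _ => by positivity)
    (by simp) (fun i _ => hF i) hq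
  simpa [Fintype.expect_eq_sum_div_card, ← Finset.mul_sum, div_eq_inv_mul] using h

lemma radMean_rpow_le {p : ℝ} (hp : 1 ≤ p) {n : ℕ} (x : Fin n → X) :
    radMean x ≤ rademacherMoment p x ^ (1 / p) := by
  have h := expect_rpow_le hp (fun ε : Fin n → ℤˣ => ‖radSum ε x‖) fun _ => norm_nonneg _
  rw [← rademacherMoment_eq_expect] at h
  rw [one_div, Real.le_rpow_inv_iff_of_pos (radMean_nonneg x) (rademacherMoment_nonneg p x)
    (by linarith)]
  exact h

/-- The Efron–Stein inequality for norms of signed sums of vectors of the unit ball: the variance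
is at most the number of vectors. -/
lemma expect_norm_sq_le (n : ℕ) : ∀ (y : X) (x : Fin n → X), (∀ i, ‖x i‖ ≤ 1) →
    𝔼 ε : Fin n → ℤˣ, ‖y + radSum ε x‖ ^ 2 ≤ (𝔼 ε : Fin n → ℤˣ, ‖y + radSum ε x‖) ^ 2 + n := by
  induction n with
  | zero =>
    intro y x _
    simp [radSum]
  | succ n ih =>
    intro y x hx
    have split : ∀ G : X → ℝ, 𝔼 ε : Fin (n + 1) → ℤˣ, G (y + radSum ε x) =
        ((𝔼 ε : Fin n → ℤˣ, G (y + x 0 + radSum ε (fun i => x i.succ))) +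
          𝔼 ε : Fin n → ℤˣ, G (y - x 0 + radSum ε (fun i => x i.succ))) / 2 := by
      intro G
      have h := Fintype.expect_equiv (Fin.consEquiv (fun _ : Fin (n + 1) => ℤˣ)).symm
        (fun ε => G (y + radSum ε x))
        (fun q => G (y + (((q.1 : ℤˣ) : ℤ) • x 0 + radSum q.2 (fun i => x i.succ)))) (by
          intro ε
          simp [radSum, Fin.sum_univ_succ, Fin.consEquiv, Fin.tail])
      rw [h, ← Finset.univ_product_univ, Finset.expect_product' _ _ (fun (a : ℤˣ) (b : Fin n → ℤˣ) =>
        G (y + ((a : ℤ) • x 0 + radSum b (fun i => x i.succ))))]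
      rw [Fintype.expect_eq_sum_div_card]
      have hu : (Finset.univ : Finset ℤˣ) = {1, -1} := rfl
      rw [hu, Finset.sum_pair (by decide)]
      simp [add_assoc, sub_eq_add_neg]
    have h1 := ih (y + x 0) (fun i => x i.succ) fun i => hx _
    have h2 := ih (y - x 0) (fun i => x i.succ) fun i => hx _
    rw [split fun z => ‖z‖ ^ 2, split fun z => ‖z‖]
    set A := 𝔼 ε : Fin n → ℤˣ, ‖y + x 0 + radSum ε (fun i => x i.succ)‖ with hA
    set B := 𝔼 ε : Fin n → ℤˣ, ‖y - x 0 + radSum ε (fun i => x i.succ)‖ with hB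
    have hx0 : ‖x 0 + x 0‖ ≤ 2 := (norm_add_le _ _).trans (by linarith [hx 0])
    have hAB : A ≤ B + 2 := by
      rw [hA, hB, ← Finset.expect_const (M := ℝ) (s := (Finset.univ : Finset (Fin n → ℤˣ)))
        Finset.univ_nonempty 2, ← Finset.expect_add_distrib]
      refine Finset.expect_le_expect fun ε _ => ?_
      calc _ = ‖(y - x 0 + radSum ε (fun i => x i.succ)) + (x 0 + x 0)‖ := by congr 1; abel
        _ ≤ _ := (norm_add_le _ _).trans (by linarith)
    have hBA : B ≤ A + 2 := by
      rw [hA, hB, ← Finset.expect_const (M := ℝ) (s := (Finset.univ : Finset (Fin n → ℤˣ)))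
        Finset.univ_nonempty 2, ← Finset.expect_add_distrib]
      refine Finset.expect_le_expect fun ε _ => ?_
      calc _ = ‖(y + x 0 + radSum ε (fun i => x i.succ)) - (x 0 + x 0)‖ := by congr 1; abel
        _ ≤ _ := (norm_sub_le _ _).trans (by linarith)
    push_cast
    -- `(A² + B²) / 2 = ((A + B) / 2)² + ((A - B) / 2)²`, and the last square is at most `1`.
    nlinarith [mul_nonneg (sub_nonneg.2 hAB) (sub_nonneg.2 hBA)]

variable [NormedSpace ℝ X]

/-- In a space of equal norm type `p` the Rademacher averages of `n` arbitrary vectors of the unit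
ball are of order `n^{1/p}`: by contraction, unit vectors are the worst case. -/
lemma IsEqualNormType.radMean_le {p : ℝ} (hp : 1 ≤ p) (h : IsEqualNormType X p) :
    ∃ c : ℝ, 0 < c ∧ ∀ (n : ℕ) (x : Fin n → X), (∀ i, ‖x i‖ ≤ 1) →
      radMean x ≤ c * (n : ℝ) ^ (1 / p) := by
  obtain ⟨c, hc, h⟩ := h
  refine ⟨c, hc, fun n x hx => ?_⟩
  rcases subsingleton_or_nontrivial X with hX | hX
  · refine (radMean_le_sum x).trans ?_
    have : ∀ i, ‖x i‖ = 0 := fun i => by rw [Subsingleton.elim (x i) 0, norm_zero]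
    simp only [this, Finset.sum_const_zero]
    positivity
  rcases Nat.eq_zero_or_pos n with rfl | hn
  · refine (radMean_le_sum x).trans ?_
    simp only [Finset.univ_eq_empty, Finset.sum_empty]
    positivity
  obtain ⟨e, he⟩ := exists_norm_eq X (zero_le_one (α := ℝ))
  have hu : ∀ i, ∃ u : X, ‖u‖ = 1 ∧ x i = ‖x i‖ • u := by
    intro i
    by_cases h0 : x i = 0
    · exact ⟨e, he, by simp [h0]⟩
    · have hne : ‖x i‖ ≠ 0 := norm_ne_zero_iff.2 h0
      exact ⟨‖x i‖⁻¹ • x i, by rw [norm_smul, norm_inv, norm_norm, inv_mul_cancel₀ hne],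
        by rw [smul_smul, mul_inv_cancel₀ hne, one_smul]⟩
  choose w hw1 hw2 using hu
  have hx' : x = fun i => ‖x i‖ • w i := funext hw2
  have hcon := radMean_contraction w (fun i => ‖x i‖) (fun i => norm_nonneg _) hx
  rw [← hx'] at hcon
  refine hcon.trans ((radMean_rpow_le hp w).trans ?_)
  refine (h n hn w fun i j => by rw [hw1, hw1]).trans_eq ?_
  simp [hw1]

/-- Conversely, a first moment bound of order `n^{1/p}` for vectors of the unit ball gives equal
norm type `p`. Since `p ≤ 2`, the variance bound `n` of the Efron–Stein inequality is of no larger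
order than `n^{2/p}`, so that the passage to the second moment is free. -/
lemma isEqualNormType_of_radMean_le {p : ℝ} (hp1 : 1 ≤ p) (hp2 : p ≤ 2) {C : ℝ} (hC : 0 ≤ C)
    (h : ∀ (n : ℕ) (x : Fin n → X), (∀ i, ‖x i‖ ≤ 1) → radMean x ≤ C * (n : ℝ) ^ (1 / p)) :
    IsEqualNormType X p := by
  have hp0 : 0 < p := by linarith
  refine ⟨C + 1, by linarith, fun n hn x hx => ?_⟩
  have hn1 : (1 : ℝ) ≤ n := by exact_mod_cast hn
  set N : ℝ := (n : ℝ) ^ (1 / p) with hN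
  have hN0 : 0 ≤ N := by positivity
  have hNsq : (n : ℝ) ≤ N ^ 2 := by
    rw [hN, ← Real.rpow_natCast, ← Real.rpow_mul (by linarith)]
    refine Real.self_le_rpow_of_one_le hn1 ?_
    rw [div_mul_eq_mul_div, one_mul, le_div_iff₀ hp0]
    simpa using hp2
  have unit : ∀ y : Fin n → X, (∀ i, ‖y i‖ ≤ 1) →
      rademacherMoment p y ^ (1 / p) ≤ (C + 1) * N := by
    intro y hy
    have h1 := expect_norm_sq_le n 0 y hy
    simp only [zero_add] at h1
    have h2 : 𝔼 ε : Fin n → ℤˣ, ‖radSum ε y‖ ^ 2 ≤ ((C + 1) * N) ^ 2 := by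
      have h3 := h n y hy
      have h4 : (radMean y) ^ 2 ≤ (C * N) ^ 2 := by
        have := radMean_nonneg y
        gcongr
      change _ ≤ (radMean y) ^ 2 + n at h1
      nlinarith [mul_nonneg hC (sq_nonneg N)]
    rw [one_div, Real.rpow_inv_le_iff_of_pos (rademacherMoment_nonneg p y) (by positivity) hp0]
    have h5 := expect_rpow_le (q := 2 / p) (by rw [le_div_iff₀ hp0]; linarith)
      (fun ε : Fin n → ℤˣ => ‖radSum ε y‖ ^ p) (fun ε => by positivity)
    rw [← rademacherMoment_eq_expect] at h5
    have h6 : ∀ t : ℝ, 0 ≤ t → (t ^ p) ^ (2 / p) = t ^ 2 := by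
      intro t ht
      rw [← Real.rpow_mul ht, mul_div_cancel₀ _ hp0.ne', Real.rpow_two]
    simp only [h6 _ (norm_nonneg _)] at h5
    have h7 : rademacherMoment p y ^ (2 / p) ≤ (((C + 1) * N) ^ p) ^ (2 / p) := by
      rw [h6 _ (by positivity)]; exact h5.trans h2
    exact (Real.rpow_le_rpow_iff (rademacherMoment_nonneg p y) (by positivity)
      (by positivity)).1 h7
  set l : ℝ := ‖x ⟨0, hn⟩‖ with hl
  have hxl : ∀ i, ‖x i‖ = l := fun i => hx _ _
  have hsum : (∑ i, ‖x i‖ ^ p) ^ (1 / p) = N * l := by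
    simp only [hxl, Finset.sum_const, Finset.card_univ, Fintype.card_fin, nsmul_eq_mul]
    rw [Real.mul_rpow (by positivity) (by positivity), ← Real.rpow_mul (norm_nonneg _),
      mul_one_div_cancel hp0.ne', Real.rpow_one]
  rw [hsum]
  have hscale : rademacherMoment p x ^ (1 / p) =
      rademacherMoment p (fun i => l⁻¹ • x i) ^ (1 / p) * l := by
    have : rademacherMoment p x = rademacherMoment p (fun i => l⁻¹ • x i) * l ^ p := by
      rw [rademacherMoment_eq_expect, rademacherMoment_eq_expect, Finset.expect_mul]
      refine Finset.expect_congr rfl fun ε _ => ?_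
      rw [← Real.mul_rpow (norm_nonneg _) (norm_nonneg _)]
      congr 1
      by_cases h0 : l = 0
      · have : ∀ i, x i = 0 := fun i => norm_eq_zero.1 ((hxl i).trans h0)
        simp [radSum, this]
      · rw [mul_comm, ← norm_smul_of_nonneg (norm_nonneg _ : 0 ≤ l), radSum, radSum, Finset.smul_sum]
        congr 1
        refine Finset.sum_congr rfl fun i _ => ?_
        rw [smul_comm, smul_smul, mul_inv_cancel₀ h0, one_smul]
    rw [this, Real.mul_rpow (rademacherMoment_nonneg _ _) (by positivity),
      ← Real.rpow_mul (norm_nonneg _), mul_one_div_cancel hp0.ne', Real.rpow_one]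
  rw [hscale, ← mul_assoc]
  refine mul_le_mul_of_nonneg_right (unit _ fun i => ?_) (norm_nonneg _)
  rw [norm_smul, norm_inv, hxl i, hl, norm_norm]
  exact inv_mul_le_one

end EqualNorm

/-! ### Deterministic algorithms against random signs -/

section Decoupling

variable {X : Type u} [NormedAddCommGroup X] [NormedSpace ℝ X]
  {ι : Type*} [Fintype ι] [DecidableEq ι]

/-- The sign pattern that is `ε` on `J` and `δ` off `J`. -/
def mixSigns (J : Finset ι) (ε δ : ι → ℤˣ) : ι → ℤˣ := fun i => if i ∈ J then ε i else δ i

omit [Fintype ι] in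
lemma mixSigns_agree (J : Finset ι) (ε δ : ι → ℤˣ) : ∀ i ∈ J, mixSigns J ε δ i = ε i :=
  fun i hi => by simp [mixSigns, hi]

omit [Fintype ι] in
lemma mixSigns_mixSigns (J : Finset ι) (ε δ : ι → ℤˣ) :
    mixSigns J (mixSigns J ε δ) (mixSigns J δ ε) = ε := by
  ext i
  by_cases h : i ∈ J <;> simp [mixSigns, h]

/-- A guess `a ε` that depends on `ε` only through its entries in a set `J ε`, itself determined by
these entries, approximates `∑ ε_i x_i` no better on average than the symmetry in the unseen signs
permits. Exchanging the signs off `J ε` with those of an independent copy is a measure preserving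
involution, which makes the unseen signs independent of the seen ones. -/
lemma card_mul_le_sum_norm (x : ι → X) (G : Finset (ι → ℤˣ)) (J : (ι → ℤˣ) → Finset ι)
    (a : (ι → ℤˣ) → X)
    (h : ∀ ε ∈ G, ∀ ε', (∀ i ∈ J ε, ε' i = ε i) → ε' ∈ G ∧ J ε' = J ε ∧ a ε' = a ε)
    {K : ℝ} (hK : ∀ ε ∈ G, radMean (fun i : J ε => x i) ≤ K) :
    (G.card : ℝ) * (radMean x - K) ≤ ∑ ε ∈ G, ‖radSum ε x - a ε‖ := by
  have hpoint : ∀ ε ∈ G, radMean x - K ≤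
      𝔼 δ : ι → ℤˣ, ‖radSum (mixSigns (J ε) ε δ) x - a (mixSigns (J ε) ε δ)‖ := by
    intro ε hε
    set D : (ι → ℤˣ) → ℝ :=
      fun δ => ‖radSum (mixSigns (J ε) ε δ) x - a (mixSigns (J ε) ε δ)‖ with hD
    have ha : ∀ δ, a (mixSigns (J ε) ε δ) = a ε := fun δ =>
      (h ε hε _ (mixSigns_agree _ _ _)).2.2
    have hsplit : ∀ δ : ι → ℤˣ, radSum δ x = ∑ i ∈ J ε, ((δ i : ℤˣ) : ℤ) • x i +
        ∑ i ∈ (J ε)ᶜ, ((δ i : ℤˣ) : ℤ) • x i := fun δ => (Finset.sum_add_sum_compl _ _).symm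
    -- Flipping all unseen signs leaves the guess unchanged, so that one of the two errors is large.
    have h1 : ∀ δ : ι → ℤˣ, ‖radSum δ x‖ ≤ ‖∑ i ∈ J ε, ((δ i : ℤˣ) : ℤ) • x i‖ +
        (D δ + D (-1 * δ)) / 2 := by
      intro δ
      have h2 : radSum (mixSigns (J ε) ε δ) x - radSum (mixSigns (J ε) ε (-1 * δ)) x =
          (2 : ℝ) • ∑ i ∈ (J ε)ᶜ, ((δ i : ℤˣ) : ℤ) • x i := by
        rw [radSum, radSum, ← Finset.sum_sub_distrib, ← Finset.sum_add_sum_compl (J ε),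
          Finset.smul_sum]
        rw [Finset.sum_eq_zero (s := J ε), zero_add]
        · refine Finset.sum_congr rfl fun i hi => ?_
          have hi' : i ∉ J ε := Finset.mem_compl.1 hi
          simp [mixSigns, hi', two_smul]
        · intro i hi
          simp [mixSigns, hi]
      have h3 : 2 * ‖∑ i ∈ (J ε)ᶜ, ((δ i : ℤˣ) : ℤ) • x i‖ ≤ D δ + D (-1 * δ) := by
        have h4 : ‖(2 : ℝ) • ∑ i ∈ (J ε)ᶜ, ((δ i : ℤˣ) : ℤ) • x i‖ =
            2 * ‖∑ i ∈ (J ε)ᶜ, ((δ i : ℤˣ) : ℤ) • x i‖ := by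
          rw [norm_smul]; norm_num
        rw [← h4, ← h2, hD]
        simp only [ha]
        rw [← sub_sub_sub_cancel_right _ _ (a ε)]
        exact norm_sub_le _ _
      rw [hsplit δ]
      refine (norm_add_le _ _).trans ?_
      linarith
    have h5 : radMean x ≤ radMean (fun i : J ε => x i) + 𝔼 δ : ι → ℤˣ, D δ := by
      calc radMean x ≤ 𝔼 δ : ι → ℤˣ, (‖∑ i ∈ J ε, ((δ i : ℤˣ) : ℤ) • x i‖ +
              (D δ + D (-1 * δ)) / 2) := Finset.expect_le_expect fun δ _ => h1 δ
        _ = _ := by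
          rw [Finset.expect_add_distrib, expect_norm_sum_finset, ← Finset.expect_div,
            Finset.expect_add_distrib, expect_mul_left (-1) D]
          ring
    linarith [hK ε hε]
  have hswap : ∑ ε ∈ G, ∑ δ : ι → ℤˣ,
      ‖radSum (mixSigns (J ε) ε δ) x - a (mixSigns (J ε) ε δ)‖ =
      ∑ ε ∈ G, ∑ _δ : ι → ℤˣ, ‖radSum ε x - a ε‖ := by
    rw [← Finset.sum_product', ← Finset.sum_product']
    have hmem : ∀ q : (ι → ℤˣ) × (ι → ℤˣ), q ∈ G ×ˢ Finset.univ →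
        (mixSigns (J q.1) q.1 q.2, mixSigns (J q.1) q.2 q.1) ∈
          G ×ˢ (Finset.univ : Finset (ι → ℤˣ)) := by
      intro q hq
      simp only [Finset.mem_product, Finset.mem_univ, and_true] at hq ⊢
      exact (h _ hq _ (mixSigns_agree _ _ _)).1
    have hinv : ∀ q : (ι → ℤˣ) × (ι → ℤˣ), q ∈ G ×ˢ Finset.univ →
        (mixSigns (J (mixSigns (J q.1) q.1 q.2)) (mixSigns (J q.1) q.1 q.2)
          (mixSigns (J q.1) q.2 q.1), mixSigns (J (mixSigns (J q.1) q.1 q.2))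
          (mixSigns (J q.1) q.2 q.1) (mixSigns (J q.1) q.1 q.2)) = q := by
      intro q hq
      simp only [Finset.mem_product, Finset.mem_univ, and_true] at hq
      rw [(h _ hq _ (mixSigns_agree _ _ _)).2.1]
      simp only [mixSigns_mixSigns]
    exact Finset.sum_nbij'
      (fun q => (mixSigns (J q.1) q.1 q.2, mixSigns (J q.1) q.2 q.1))
      (fun q => (mixSigns (J q.1) q.1 q.2, mixSigns (J q.1) q.2 q.1))
      hmem hmem hinv hinv (fun q _ => rfl)
  calc (G.card : ℝ) * (radMean x - K) = ∑ _ε ∈ G, (radMean x - K) := by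
        rw [Finset.sum_const, nsmul_eq_mul]
    _ ≤ ∑ ε ∈ G, 𝔼 δ : ι → ℤˣ,
        ‖radSum (mixSigns (J ε) ε δ) x - a (mixSigns (J ε) ε δ)‖ := Finset.sum_le_sum hpoint
    _ = ∑ ε ∈ G, ‖radSum ε x - a ε‖ := by
      simp only [Fintype.expect_eq_sum_div_card]
      rw [← Finset.sum_div, hswap]
      simp only [Finset.sum_const, Finset.card_univ, nsmul_eq_mul, ← Finset.mul_sum]
      rw [mul_div_cancel_left₀]
      exact_mod_cast Fintype.card_ne_zero

end Decoupling

namespace DetAlg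

variable {d : ℕ} {X : Type u} {ι : Type*} [DecidableEq ι]

lemma card_eq_coe_iff (A : DetAlg d X) (f : (Fin d → ℝ) → X) (m : ℕ) :
    A.card f = m ↔ A.halt m (A.values f m) = true ∧
      ∀ k < m, ¬ A.halt k (A.values f k) = true := by
  classical
  unfold card
  split_ifs with h
  · rw [Nat.cast_inj]
    exact Nat.find_eq_iff h
  · simp only [ENat.top_ne_natCast, false_iff, not_and]
    exact fun hm => (h ⟨m, hm⟩).elim

lemma result_eq_of_card_eq [Zero X] (A : DetAlg d X) (f : (Fin d → ℝ) → X) {m : ℕ}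
    (h : A.card f = m) : A.result f = A.output m (A.values f m) := by
  classical
  have h' := (card_eq_coe_iff A f m).1 h
  have hH : A.Halts f := ⟨m, h'.1⟩
  have hm : Nat.find hH = m := (Nat.find_eq_iff hH).2 h'
  unfold result
  rw [dif_pos hH]
  have : ∀ k, k = m → A.output k (A.values f k) = A.output m (A.values f m) := by
    rintro k rfl; rfl
  convert this _ hm

/-- The labels, under `cell`, of the first `n` nodes used on input `f`. -/
def seen (A : DetAlg d X) (cell : cube d → ι) (f : (Fin d → ℝ) → X) : ℕ → Finset ι
  | 0 => ∅
  | n + 1 => insert (cell (A.node n (A.values f n))) (seen A cell f n)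

lemma card_seen_le (A : DetAlg d X) (cell : cube d → ι) (f : (Fin d → ℝ) → X) (n : ℕ) :
    (A.seen cell f n).card ≤ n := by
  induction n with
  | zero => simp [seen]
  | succ n ih => exact (Finset.card_insert_le _ _).trans (by omega)

lemma seen_mono (A : DetAlg d X) (cell : cube d → ι) (f : (Fin d → ℝ) → X) :
    Monotone (A.seen cell f) :=
  monotone_nat_of_le_succ fun _ => Finset.subset_insert _ _

/-- If the value of `f ε` at `t` depends on `ε` only through the sign with the label of `t`, then
the information collected in `n` steps is determined by the signs seen. -/
lemma values_congr (A : DetAlg d X) (cell : cube d → ι) (f : (ι → ℤˣ) → (Fin d → ℝ) → X)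
    (hf : ∀ (ε ε' : ι → ℤˣ) (t : cube d), ε (cell t) = ε' (cell t) → f ε t = f ε' t)
    (ε ε' : ι → ℤˣ) (n : ℕ) (h : ∀ i ∈ A.seen cell (f ε) n, ε' i = ε i) :
    A.values (f ε') n = A.values (f ε) n ∧ A.seen cell (f ε') n = A.seen cell (f ε) n := by
  induction n with
  | zero => exact ⟨rfl, rfl⟩
  | succ n ih =>
    obtain ⟨h1, h2⟩ := ih fun i hi => h i (Finset.mem_insert_of_mem hi)
    have h3 := h _ (Finset.mem_insert_self _ _)
    constructor
    · simp only [values]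
      rw [h1, hf ε' ε _ h3]
    · simp only [seen]
      rw [h1, h2]

lemma card_congr (A : DetAlg d X) (cell : cube d → ι) (f : (ι → ℤˣ) → (Fin d → ℝ) → X)
    (hf : ∀ (ε ε' : ι → ℤˣ) (t : cube d), ε (cell t) = ε' (cell t) → f ε t = f ε' t)
    (ε ε' : ι → ℤˣ) (m : ℕ) (hm : A.card (f ε) = m)
    (h : ∀ i ∈ A.seen cell (f ε) m, ε' i = ε i) : A.card (f ε') = m := by
  rw [card_eq_coe_iff] at hm ⊢
  have hv : ∀ k ≤ m, A.values (f ε') k = A.values (f ε) k := fun k hk =>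
    (A.values_congr cell f hf ε ε' k fun i hi => h i (A.seen_mono cell _ hk hi)).1
  refine ⟨by rw [hv m le_rfl]; exact hm.1, fun k hk => ?_⟩
  rw [hv k hk.le]
  exact hm.2 k hk

end DetAlg

section LowerBound

variable {d : ℕ} {X : Type u} [NormedAddCommGroup X] [NormedSpace ℝ X]
  {ι : Type*} [Fintype ι] [DecidableEq ι]

open Classical in
/-- The average case lower bound for a deterministic adaptive algorithm, restricted to the inputs on
which it uses at most `M` function values. -/
lemma DetAlg.card_mul_le_sum_error (A : DetAlg d X) (cell : cube d → ι)
    (f : (ι → ℤˣ) → (Fin d → ℝ) → X)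
    (hf : ∀ (ε ε' : ι → ℤˣ) (t : cube d), ε (cell t) = ε' (cell t) → f ε t = f ε' t)
    (x : ι → X) (M : ℕ) {K : ℝ}
    (hK : ∀ J : Finset ι, J.card ≤ M → radMean (fun i : J => x i) ≤ K) :
    ((Finset.univ.filter fun ε => A.card (f ε) ≤ M).card : ℝ) * (radMean x - K) ≤
      ∑ ε, ‖radSum ε x - A.result (f ε)‖ := by
  refine (card_mul_le_sum_norm x (Finset.univ.filter fun ε => A.card (f ε) ≤ M)
    (fun ε => A.seen cell (f ε) (A.card (f ε)).toNat) (fun ε => A.result (f ε)) ?_ ?_).trans ?_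
  · intro ε hε ε' hε'
    simp only [Finset.mem_filter, Finset.mem_univ, true_and] at hε ⊢
    obtain ⟨m, hm⟩ := ENat.ne_top_iff_exists.1 (ne_top_of_le_ne_top (ENat.natCast_ne_top M) hε)
    rw [← hm, ENat.toNat_natCast] at hε'
    have hc := A.card_congr cell f hf ε ε' m hm.symm hε'
    have hv := A.values_congr cell f hf ε ε' m hε'
    refine ⟨by rw [hc, hm]; exact hε, ?_, ?_⟩
    · rw [hc, ← hm, ENat.toNat_natCast, hv.2]
    · rw [A.result_eq_of_card_eq _ hc, A.result_eq_of_card_eq _ hm.symm, hv.1]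
  · intro ε hε
    simp only [Finset.mem_filter, Finset.mem_univ, true_and] at hε
    exact hK _ ((A.card_seen_le _ _ _).trans (ENat.toNat_le_of_le_natCast hε))
  · exact Finset.sum_le_sum_of_subset_of_nonneg (Finset.filter_subset _ _)
      fun _ _ _ => norm_nonneg _

/-- The lower bound for randomized algorithms: if the inputs `f ε` of the unit ball have integrals
`∑ ε_i x_i`, and Rademacher averages over at most `2 n` of the `x_i` are at most `K`, then
`E ‖∑ ε_i x_i‖ - K` is at most twice the error of any algorithm using `n` values on average. -/
lemma radMean_sub_le_randError {r n : ℕ} (hn : 1 ≤ n) {Ω : Type v} [MeasurableSpace Ω]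
    {P : Measure Ω} {A : Ω → DetAlg d X} (hA : IsRandAlg r n P A) (cell : cube d → ι)
    (f : (ι → ℤˣ) → (Fin d → ℝ) → X)
    (hf : ∀ (ε ε' : ι → ℤˣ) (t : cube d), ε (cell t) = ε' (cell t) → f ε t = f ε' t)
    (hball : ∀ ε, f ε ∈ crBall d X r) (x : ι → X) (hint : ∀ ε, integralOp (f ε) = radSum ε x)
    {K : ℝ} (hK : ∀ J : Finset ι, J.card ≤ 2 * n → radMean (fun i : J => x i) ≤ K) :
    ENNReal.ofReal (radMean x - K) ≤ 2 * randError r P A := by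
  classical
  have := hA.prob
  set b := ENNReal.ofReal (radMean x - K) with hb
  have hbtop : b ≠ ⊤ := ENNReal.ofReal_ne_top
  set N : ℝ≥0∞ := ((Fintype.card (ι → ℤˣ) : ℕ) : ℝ≥0∞) with hN
  have hN0 : N ≠ 0 := by rw [hN]; exact_mod_cast Fintype.card_ne_zero
  have hNtop : N ≠ ⊤ := ENNReal.natCast_ne_top _
  have hM0 : (2 * n : ℝ≥0∞) ≠ 0 := by
    simp only [ne_eq, mul_eq_zero, OfNat.ofNat_ne_zero, false_or, Nat.cast_eq_zero]; omega
  have hMtop : (2 * n : ℝ≥0∞) ≠ ⊤ := by finiteness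
  have hpoint : ∀ ω, N * b ≤ ∑ ε, ‖integralOp (f ε) - (A ω).result (f ε)‖ₑ +
      b * ∑ ε, ((((A ω).card (f ε) : ℕ∞) : ℝ≥0∞) / (2 * n)) := by
    intro ω
    set G := Finset.univ.filter fun ε => (A ω).card (f ε) ≤ (2 * n : ℕ) with hG
    have h1 : (G.card : ℝ≥0∞) * b ≤ ∑ ε, ‖integralOp (f ε) - (A ω).result (f ε)‖ₑ := by
      have h2 := (A ω).card_mul_le_sum_error cell f hf x (2 * n) hK
      have h3 := ENNReal.ofReal_le_ofReal h2
      rw [ENNReal.ofReal_mul (by positivity), ENNReal.ofReal_natCast,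
        ENNReal.ofReal_sum_of_nonneg fun _ _ => norm_nonneg _] at h3
      simp only [ofReal_norm] at h3
      simp only [hint]
      exact h3
    -- Markov's inequality: outside `G` the cardinality exceeds `2 n`.
    have h4 : N ≤ G.card + ∑ ε, ((((A ω).card (f ε) : ℕ∞) : ℝ≥0∞) / (2 * n)) := by
      have h5 : N = ∑ _ε : ι → ℤˣ, (1 : ℝ≥0∞) := by simp [hN]
      have h6 : (G.card : ℝ≥0∞) = ∑ ε : ι → ℤˣ, if (A ω).card (f ε) ≤ (2 * n : ℕ) then 1 else 0 := by
        rw [hG, Finset.sum_boole]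
      rw [h5, h6, ← Finset.sum_add_distrib]
      refine Finset.sum_le_sum fun ε _ => ?_
      split_ifs with h
      · exact le_self_add
      · rw [zero_add, ENNReal.le_div_iff_mul_le (Or.inl hM0) (Or.inl hMtop), one_mul]
        have := ENat.toENNReal_le.2 (not_le.1 h).le
        simpa using this
    calc N * b ≤ (G.card + ∑ ε, ((((A ω).card (f ε) : ℕ∞) : ℝ≥0∞) / (2 * n))) * b := by gcongr
      _ ≤ _ := by rw [add_mul, mul_comm _ b, mul_comm _ b]; gcongr; rwa [mul_comm]
  have hmres : ∀ ε, Measurable fun ω => ‖integralOp (f ε) - (A ω).result (f ε)‖ₑ := by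
    intro ε
    let _ : MeasurableSpace X := borel X
    have _ : BorelSpace X := ⟨rfl⟩
    have hc : Measurable fun y : X => ‖integralOp (f ε) - y‖ₑ :=
      (continuous_enorm.comp (continuous_const.sub continuous_id)).measurable
    exact hc.comp (hA.measurable_result _ (hball ε))
  have hmcard : ∀ ε, Measurable fun ω => ((((A ω).card (f ε) : ℕ∞) : ℝ≥0∞) / (2 * n)) := by
    intro ε
    exact ((measurable_from_top (f := fun m : ℕ∞ => (m : ℝ≥0∞))).comp
      (hA.measurable_card _ (hball ε))).div_const _
  have hmain : N * b ≤ N * randError r P A + N * (b / 2) := by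
    calc N * b = ∫⁻ _ω, N * b ∂P := by simp
      _ ≤ ∫⁻ ω, (∑ ε, ‖integralOp (f ε) - (A ω).result (f ε)‖ₑ +
          b * ∑ ε, ((((A ω).card (f ε) : ℕ∞) : ℝ≥0∞) / (2 * n))) ∂P := lintegral_mono hpoint
      _ = ∑ ε, ∫⁻ ω, ‖integralOp (f ε) - (A ω).result (f ε)‖ₑ ∂P +
          b * ∑ ε, (∫⁻ ω, (((A ω).card (f ε) : ℕ∞) : ℝ≥0∞) ∂P) / (2 * n) := by
        rw [lintegral_add_left (Finset.measurable_sum _ fun ε _ => hmres ε),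
          lintegral_const_mul' _ _ hbtop, lintegral_finsetSum _ fun ε _ => hmres ε,
          lintegral_finsetSum _ fun ε _ => hmcard ε]
        simp only [div_eq_mul_inv]
        congr 2
        refine Finset.sum_congr rfl fun ε _ => ?_
        rw [lintegral_mul_const' _ _ (ENNReal.inv_ne_top.2 hM0)]
      _ ≤ ∑ _ε : ι → ℤˣ, randError r P A + b * ∑ _ε : ι → ℤˣ, (2 : ℝ≥0∞)⁻¹ := by
        gcongr with ε _ ε _
        · exact le_iSup₂_of_le (f ε) (hball ε) le_rfl
        · refine (ENNReal.div_le_div_right (hA.card_le _ (hball ε)) _).trans (le_of_eq ?_)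
          have hn0 : (n : ℝ≥0∞) ≠ 0 := by exact_mod_cast (by omega : n ≠ 0)
          rw [mul_comm (2 : ℝ≥0∞), ENNReal.div_eq_inv_mul,
            ENNReal.mul_inv (Or.inl hn0) (Or.inl (ENNReal.natCast_ne_top n)),
            mul_right_comm, ENNReal.inv_mul_cancel hn0 (ENNReal.natCast_ne_top n), one_mul]
      _ = _ := by
        simp only [Finset.sum_const, Finset.card_univ, nsmul_eq_mul, ← hN]
        rw [div_eq_mul_inv]; ring
  rw [← mul_add, ENNReal.mul_le_mul_iff_right hN0 hNtop] at hmain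
  have hhalf : b = b / 2 + b / 2 := (ENNReal.add_halves b).symm
  have h7 : b / 2 ≤ randError r P A := by
    have : b / 2 + b / 2 ≤ randError r P A + b / 2 := by rwa [← hhalf]
    exact (ENNReal.add_le_add_iff_right (ENNReal.div_ne_top hbtop (by norm_num))).1 this
  calc b = b / 2 + b / 2 := hhalf
    _ ≤ randError r P A + randError r P A := add_le_add h7 h7
    _ = 2 * randError r P A := (two_mul _).symm

end LowerBound

/-! ### Fooling functions -/

lemma uniqueDiffOn_cube (d : ℕ) : UniqueDiffOn ℝ (cube d) := by
  have : cube d = Set.univ.pi fun _ : Fin d => Set.Icc (0 : ℝ) 1 := by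
    rw [cube, ← Set.pi_univ_Icc]; rfl
  rw [this]
  exact UniqueDiffOn.univ_pi fun _ => uniqueDiffOn_Icc zero_lt_one

lemma isCompact_cube (d : ℕ) : IsCompact (cube d) := isCompact_Icc

lemma measurableSet_cube (d : ℕ) : MeasurableSet (cube d) := measurableSet_Icc

section Bumps

/-- A bump function supported well inside the unit cube, normalized in `C^r`. -/
lemma exists_bump (d r : ℕ) : ∃ ψ : (Fin d → ℝ) → ℝ, ContDiff ℝ r ψ ∧
    (tsupport ψ ⊆ Metric.closedBall (fun _ => 1 / 2) (1 / 4)) ∧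
    (∀ k ≤ r, ∀ t, ‖iteratedFDeriv ℝ k ψ t‖ ≤ 1) ∧ 0 < ∫ t, ψ t := by
  let b : ContDiffBump (fun _ : Fin d => (1 / 2 : ℝ)) := ⟨1 / 8, 1 / 4, by norm_num, by norm_num⟩
  have hb : ContDiff ℝ r b := b.contDiff
  have hD : ∀ k : ℕ, ∃ D : ℝ, k ≤ r → ∀ t, ‖iteratedFDeriv ℝ k b t‖ ≤ D := by
    intro k
    by_cases hk : k ≤ r
    · obtain ⟨D, hD⟩ := (hb.continuous_iteratedFDeriv (m := k)
        (by exact_mod_cast hk)).bounded_above_of_compact_support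
          (b.hasCompactSupport.iteratedFDeriv k)
      exact ⟨D, fun _ => hD⟩
    · exact ⟨0, fun h => (hk h).elim⟩
  choose D hD using hD
  set D' := 1 + ∑ k ∈ Finset.range (r + 1), |D k| with hD'
  have hD0 : 0 < D' := by positivity
  have hle : ∀ k ≤ r, D k ≤ D' := by
    intro k hk
    have h1 := Finset.single_le_sum (f := fun k => |D k|) (fun _ _ => abs_nonneg _)
      (Finset.mem_range.2 (Nat.lt_succ_of_le hk))
    have h2 := le_abs_self (D k)
    linarith
  refine ⟨fun t => D'⁻¹ • b t, hb.const_smul D'⁻¹, ?_, ?_, ?_⟩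
  · have h0 : Function.support (fun t => D'⁻¹ • b t) ⊆ Function.support b :=
      fun t ht h0 => ht (by simp [h0])
    refine (closure_mono h0).trans ?_
    change tsupport b ⊆ _
    rw [b.tsupport_eq]
  · intro k hk t
    have : iteratedFDeriv ℝ k (fun t => D'⁻¹ • b t) t = D'⁻¹ • iteratedFDeriv ℝ k b t :=
      iteratedFDeriv_const_smul_apply' (hb.contDiffAt.of_le (by exact_mod_cast hk))
    rw [this, norm_smul, norm_inv, Real.norm_of_nonneg hD0.le, inv_mul_le_iff₀ hD0, mul_one]
    exact (hD k hk t).trans (hle k hk)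
  · rw [integral_smul]
    exact smul_pos (inv_pos.2 hD0) b.integral_pos

variable {d r m : ℕ} {ψ : (Fin d → ℝ) → ℝ}

/-- The function `ψ` moved to the subcube of side `1 / m` with corner `a / m`. -/
def scaledBump (ψ : (Fin d → ℝ) → ℝ) (m : ℕ) (a : Fin d → Fin m) (t : Fin d → ℝ) : ℝ :=
  ψ ((m : ℝ) • t - fun l => ((a l : ℕ) : ℝ))

lemma abs_sub_le_of_mem_tsupport (hs : tsupport ψ ⊆ Metric.closedBall (fun _ => 1 / 2) (1 / 4))
    {a : Fin d → Fin m} {t : Fin d → ℝ}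
    (h : ((m : ℝ) • t - fun l => ((a l : ℕ) : ℝ)) ∈ tsupport ψ) (l : Fin d) :
    |m * t l - (a l : ℕ) - 1 / 2| ≤ 1 / 4 := by
  have h1 := hs h
  rw [mem_closedBall_iff_norm] at h1
  have h2 := (norm_le_pi_norm _ l).trans h1
  simpa using h2

/-- The supports of different scaled bumps are disjoint, even after taking closures: the support of
`ψ` stays away from the faces of the cube. This makes a sum of bumps no larger in `C^r` than a single
one. -/
lemma eq_of_mem_tsupport (hs : tsupport ψ ⊆ Metric.closedBall (fun _ => 1 / 2) (1 / 4))
    {a a' : Fin d → Fin m} {t : Fin d → ℝ}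
    (h : ((m : ℝ) • t - fun l => ((a l : ℕ) : ℝ)) ∈ tsupport ψ)
    (h' : ((m : ℝ) • t - fun l => ((a' l : ℕ) : ℝ)) ∈ tsupport ψ) : a = a' := by
  ext l
  have h1 := abs_le.1 (abs_sub_le_of_mem_tsupport hs h l)
  have h2 := abs_le.1 (abs_sub_le_of_mem_tsupport hs h' l)
  have h3 : ((a l : ℕ) : ℝ) < (a' l : ℕ) + 1 := by linarith [h1.1, h1.2, h2.1, h2.2]
  have h4 : ((a' l : ℕ) : ℝ) < (a l : ℕ) + 1 := by linarith [h1.1, h1.2, h2.1, h2.2]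
  have h5 : (a l : ℕ) < (a' l : ℕ) + 1 := by exact_mod_cast h3
  have h6 : (a' l : ℕ) < (a l : ℕ) + 1 := by exact_mod_cast h4
  omega

lemma mem_cube_of_mem_tsupport (hs : tsupport ψ ⊆ Metric.closedBall (fun _ => 1 / 2) (1 / 4))
    (hm : 1 ≤ m) {a : Fin d → Fin m} {t : Fin d → ℝ}
    (h : ((m : ℝ) • t - fun l => ((a l : ℕ) : ℝ)) ∈ tsupport ψ) : t ∈ cube d := by
  have hm' : (0 : ℝ) < m := by exact_mod_cast hm
  refine ⟨fun l => ?_, fun l => ?_⟩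
  · have h1 := abs_le.1 (abs_sub_le_of_mem_tsupport hs h l)
    have : (0 : ℝ) ≤ m * t l := by
      have : (0 : ℝ) ≤ (a l : ℕ) := by positivity
      linarith [h1.1]
    exact nonneg_of_mul_nonneg_right this hm'
  · have h1 := abs_le.1 (abs_sub_le_of_mem_tsupport hs h l)
    have h2 : ((a l : ℕ) : ℝ) + 1 ≤ m := by exact_mod_cast (a l).isLt
    have : (m : ℝ) * t l ≤ m * 1 := by linarith [h1.2]
    exact le_of_mul_le_mul_left this hm'

lemma contDiff_scaledBump (hψ : ContDiff ℝ r ψ) (a : Fin d → Fin m) :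
    ContDiff ℝ r (scaledBump ψ m a) :=
  hψ.comp ((contDiff_id.const_smul _).sub contDiff_const)

lemma norm_iteratedFDeriv_scaledBump_le (hψ : ContDiff ℝ r ψ) (a : Fin d → Fin m) {k : ℕ}
    (hk : k ≤ r) (t : Fin d → ℝ) : ‖iteratedFDeriv ℝ k (scaledBump ψ m a) t‖ ≤
      ‖iteratedFDeriv ℝ k ψ ((m : ℝ) • t - fun l => ((a l : ℕ) : ℝ))‖ * (m : ℝ) ^ k := by
  set c : Fin d → ℝ := fun l => ((a l : ℕ) : ℝ) with hc
  set g : (Fin d → ℝ) →L[ℝ] (Fin d → ℝ) := (m : ℝ) • ContinuousLinearMap.id ℝ _ with hg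
  have h1 : ContDiff ℝ r fun z => ψ (z - c) := hψ.comp (contDiff_id.sub contDiff_const)
  have h2 : scaledBump ψ m a = (fun z => ψ (z - c)) ∘ g := by
    ext t; simp [scaledBump, hg, hc]
  have h3 : iteratedFDeriv ℝ k (fun z => ψ (z - c)) (g t) =
      iteratedFDeriv ℝ k ψ ((m : ℝ) • t - c) := by
    rw [iteratedFDeriv_comp_sub]; simp [hg]
  rw [h2, g.iteratedFDeriv_comp_right h1 t (by exact_mod_cast hk), h3]
  refine (ContinuousMultilinearMap.norm_compContinuousLinearMap_le _ _).trans ?_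
  rw [Finset.prod_const, Finset.card_univ, Fintype.card_fin]
  have h4 : ‖g‖ ≤ m := by
    rw [hg, norm_smul]
    refine (mul_le_mul_of_nonneg_left ContinuousLinearMap.norm_id_le (norm_nonneg _)).trans ?_
    simp
  gcongr

lemma integral_scaledBump (a : Fin d → Fin m) :
    ∫ t, scaledBump ψ m a t = ((m : ℝ) ^ d)⁻¹ * ∫ t, ψ t := by
  have h := Measure.integral_comp_smul (volume : Measure (Fin d → ℝ))
    (fun z => ψ (z - fun l => ((a l : ℕ) : ℝ))) (m : ℝ)
  rw [integral_sub_right_eq_self] at h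
  refine h.trans ?_
  rw [Module.finrank_fin_fun, abs_of_nonneg (by positivity), smul_eq_mul]

variable {X : Type u} [NormedAddCommGroup X] [NormedSpace ℝ X]
  {ι : Type*} [Fintype ι]

/-- The fooling function: on the subcube with label `e i` a bump with values in the direction of
`ε_i x_i`. -/
noncomputable def fooling (ψ : (Fin d → ℝ) → ℝ) (r m : ℕ) (e : ι → Fin d → Fin m) (x : ι → X)
    (ε : ι → ℤˣ) (t : Fin d → ℝ) : X :=
  ∑ i, scaledBump ψ m (e i) t • ((m : ℝ) ^ r)⁻¹ • ((ε i : ℤˣ) : ℤ) • x i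

lemma contDiff_fooling (hψ : ContDiff ℝ r ψ) (e : ι → Fin d → Fin m) (x : ι → X)
    (ε : ι → ℤˣ) : ContDiff ℝ r (fooling ψ r m e x ε) :=
  ContDiff.sum fun i _ => (contDiff_scaledBump hψ (e i)).smul contDiff_const

lemma norm_iteratedFDeriv_fooling_le (hψ : ContDiff ℝ r ψ)
    (hs : tsupport ψ ⊆ Metric.closedBall (fun _ => 1 / 2) (1 / 4))
    (hb : ∀ k ≤ r, ∀ t, ‖iteratedFDeriv ℝ k ψ t‖ ≤ 1) (hm : 1 ≤ m)
    {e : ι → Fin d → Fin m} (he : Function.Injective e) {x : ι → X} (hx : ∀ i, ‖x i‖ ≤ 1)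
    (ε : ι → ℤˣ) {k : ℕ} (hk : k ≤ r) (t : Fin d → ℝ) :
    ‖iteratedFDeriv ℝ k (fooling ψ r m e x ε) t‖ ≤ 1 := by
  classical
  have hm' : (1 : ℝ) ≤ m := by exact_mod_cast hm
  set y : ι → X := fun i => ((m : ℝ) ^ r)⁻¹ • ((ε i : ℤˣ) : ℤ) • x i with hy
  have hyn : ∀ i, ‖y i‖ ≤ ((m : ℝ) ^ r)⁻¹ := by
    intro i
    rw [hy]
    simp only
    rw [norm_smul, norm_units_smul, Real.norm_of_nonneg (by positivity)]
    exact mul_le_of_le_one_right (by positivity) (hx i)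
  have hterm : ∀ i, ‖iteratedFDeriv ℝ k (fun t => scaledBump ψ m (e i) t • y i) t‖ ≤
      ‖y i‖ * ‖iteratedFDeriv ℝ k (scaledBump ψ m (e i)) t‖ := by
    intro i
    have h := ((1 : ℝ →L[ℝ] ℝ).smulRight (y i)).norm_iteratedFDeriv_comp_left
      (contDiff_scaledBump hψ (e i)).contDiffAt (x := t) (n := k) (by exact_mod_cast hk)
    refine le_trans (le_of_eq ?_) (h.trans (le_of_eq ?_))
    · rfl
    · rw [ContinuousLinearMap.norm_smulRight_apply]; simp
  have hsum : iteratedFDeriv ℝ k (fooling ψ r m e x ε) t =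
      ∑ i, iteratedFDeriv ℝ k (fun t => scaledBump ψ m (e i) t • y i) t := by
    exact iteratedFDeriv_fun_sum_apply fun i _ =>
      (((contDiff_scaledBump hψ (e i)).smul contDiff_const).of_le
        (by exact_mod_cast hk)).contDiffAt
  rw [hsum]
  have hzero : ∀ i, ((m : ℝ) • t - fun l => ((e i l : ℕ) : ℝ)) ∉ tsupport ψ →
      iteratedFDeriv ℝ k (fun t => scaledBump ψ m (e i) t • y i) t = 0 := by
    intro i hi
    have h0 : iteratedFDeriv ℝ k ψ ((m : ℝ) • t - fun l => ((e i l : ℕ) : ℝ)) = 0 := by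
      by_contra hne
      exact hi (support_iteratedFDeriv_subset k hne)
    have h1 := norm_iteratedFDeriv_scaledBump_le hψ (e i) hk t
    rw [h0, norm_zero, zero_mul] at h1
    have h2 := (hterm i).trans (mul_le_mul_of_nonneg_left h1 (norm_nonneg _))
    rw [mul_zero] at h2
    exact norm_le_zero_iff.1 h2
  by_cases hex : ∃ i, ((m : ℝ) • t - fun l => ((e i l : ℕ) : ℝ)) ∈ tsupport ψ
  · obtain ⟨i, hi⟩ := hex
    rw [Finset.sum_eq_single i (fun j _ hj => hzero j fun hjs =>
      hj (he (eq_of_mem_tsupport hs hjs hi))) (fun h => (h (Finset.mem_univ _)).elim)]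
    have h1 := norm_iteratedFDeriv_scaledBump_le hψ (e i) hk t
    calc _ ≤ ‖y i‖ * ‖iteratedFDeriv ℝ k (scaledBump ψ m (e i)) t‖ := hterm i
      _ ≤ ((m : ℝ) ^ r)⁻¹ * (1 * (m : ℝ) ^ r) := by
        refine mul_le_mul (hyn i) (h1.trans ?_) (norm_nonneg _) (by positivity)
        exact mul_le_mul (hb k hk _) (pow_le_pow_right₀ hm' hk) (by positivity) zero_le_one
      _ = 1 := by rw [one_mul, inv_mul_cancel₀ (by positivity)]
  · rw [Finset.sum_eq_zero fun i _ => hzero i fun hi => hex ⟨i, hi⟩, norm_zero]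
    exact zero_le_one

lemma norm_partialDeriv_le_of_iteratedFDeriv {f : (Fin d → ℝ) → X} (hf : ContDiff ℝ r f) {k : ℕ}
    (hk : k ≤ r) (i : Fin k → Fin d) {t : Fin d → ℝ} (ht : t ∈ cube d) :
    ‖partialDeriv i f t‖ ≤ ‖iteratedFDeriv ℝ k f t‖ := by
  rw [partialDeriv, iteratedFDerivWithin_eq_iteratedFDeriv (uniqueDiffOn_cube d)
    (hf.contDiffAt.of_le (by exact_mod_cast hk)) ht]
  refine (ContinuousMultilinearMap.le_opNorm _ _).trans (le_of_eq ?_)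
  rw [Finset.prod_eq_one fun j _ => by simp [Pi.norm_single], mul_one]

lemma fooling_mem_crBall (hψ : ContDiff ℝ r ψ)
    (hs : tsupport ψ ⊆ Metric.closedBall (fun _ => 1 / 2) (1 / 4))
    (hb : ∀ k ≤ r, ∀ t, ‖iteratedFDeriv ℝ k ψ t‖ ≤ 1) (hm : 1 ≤ m)
    {e : ι → Fin d → Fin m} (he : Function.Injective e) {x : ι → X} (hx : ∀ i, ‖x i‖ ≤ 1)
    (ε : ι → ℤˣ) : fooling ψ r m e x ε ∈ crBall d X r := by
  refine ⟨(contDiff_fooling hψ e x ε).contDiffOn, ?_⟩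
  simp only [crNorm, iSup_le_iff]
  intro k hk i t ht
  rw [← ofReal_norm, ENNReal.ofReal_le_one]
  exact (norm_partialDeriv_le_of_iteratedFDeriv (contDiff_fooling hψ e x ε) hk i ht).trans
    (norm_iteratedFDeriv_fooling_le hψ hs hb hm he hx ε hk t)

/-- A point of the cube meets at most one bump, so that the value of the fooling function there
depends on one sign only. -/
lemma exists_cell [Nonempty ι] (hs : tsupport ψ ⊆ Metric.closedBall (fun _ => 1 / 2) (1 / 4))
    {e : ι → Fin d → Fin m} (he : Function.Injective e) (x : ι → X) :
    ∃ cell : cube d → ι, ∀ (ε ε' : ι → ℤˣ) (t : cube d), ε (cell t) = ε' (cell t) →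
      fooling ψ r m e x ε t = fooling ψ r m e x ε' t := by
  have h : ∀ t : cube d, ∃ i : ι, ∀ j, scaledBump ψ m (e j) t ≠ 0 → j = i := by
    intro t
    by_cases hex : ∃ i, scaledBump ψ m (e i) t ≠ 0
    · obtain ⟨i, hi⟩ := hex
      exact ⟨i, fun j hj => he (eq_of_mem_tsupport hs (subset_tsupport _ hj)
        (subset_tsupport _ hi))⟩
    · exact ⟨Classical.arbitrary ι, fun j hj => (hex ⟨j, hj⟩).elim⟩
  choose cell hcell using h
  refine ⟨cell, fun ε ε' t ht => Finset.sum_congr rfl fun i _ => ?_⟩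
  by_cases h0 : scaledBump ψ m (e i) t = 0
  · rw [h0, zero_smul, zero_smul]
  · rw [hcell t i h0, ht]

variable [CompleteSpace X]

lemma integralOp_fooling (hψ : ContDiff ℝ r ψ)
    (hs : tsupport ψ ⊆ Metric.closedBall (fun _ => 1 / 2) (1 / 4)) (hm : 1 ≤ m)
    (e : ι → Fin d → Fin m) (x : ι → X) (ε : ι → ℤˣ) :
    integralOp (fooling ψ r m e x ε) =
      radSum ε (fun i => (((m : ℝ) ^ (r + d))⁻¹ * ∫ t, ψ t) • x i) := by
  unfold integralOp fooling radSum
  rw [integral_finsetSum]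
  · refine Finset.sum_congr rfl fun i _ => ?_
    rw [integral_smul_const, setIntegral_eq_integral_of_forall_compl_eq_zero, integral_scaledBump,
      smul_smul, smul_comm _ ((ε i : ℤˣ) : ℤ)]
    · congr 2
      rw [pow_add, mul_inv]; ring
    · intro t ht
      by_contra h0
      exact ht (mem_cube_of_mem_tsupport hs hm (subset_tsupport _ h0))
  · intro i _
    exact ((((contDiff_scaledBump hψ (e i)).continuous).smul
      continuous_const).continuousOn.integrableOn_compact (isCompact_cube d))

end Bumps

/-! ### From the rate of the minimal errors to equal norm type -/

/-- A side length `m` such that the `m ^ d` subcubes suffice for `N` labels, but are not many more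
than that. -/
lemma exists_pow_ge {d : ℕ} (hd : 1 ≤ d) {N : ℕ} (hN : 1 ≤ N) :
    ∃ m : ℕ, 1 ≤ m ∧ N ≤ m ^ d ∧ (m : ℝ) ≤ 2 * (N : ℝ) ^ (1 / (d : ℝ)) := by
  have hd0 : (0 : ℝ) < d := by exact_mod_cast hd
  have hN1 : (1 : ℝ) ≤ N := by exact_mod_cast hN
  set s : ℝ := (N : ℝ) ^ (1 / (d : ℝ)) with hs
  have hs1 : 1 ≤ s := Real.one_le_rpow hN1 (by positivity)
  refine ⟨⌈s⌉₊, Nat.ceil_pos.2 (by linarith), ?_, ?_⟩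
  · have h1 : (N : ℝ) = s ^ d := by
      rw [hs, ← Real.rpow_natCast, ← Real.rpow_mul (by linarith), one_div_mul_cancel hd0.ne',
        Real.rpow_one]
    have h2 : (N : ℝ) ≤ (⌈s⌉₊ : ℝ) ^ d := by
      rw [h1]
      exact pow_le_pow_left₀ (by linarith) (Nat.le_ceil s) d
    exact_mod_cast h2
  · have := Nat.ceil_lt_add_one (by linarith : 0 ≤ s)
    linarith

variable {X : Type u} [NormedAddCommGroup X] [NormedSpace ℝ X] [CompleteSpace X]

/-- The lower bound for the minimal error: Rademacher averages over `ι` exceed those over few of the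
indices by at most a multiple of the minimal error. -/
lemma radMean_sub_le_ranMinError {d r m n : ℕ} (hn : 1 ≤ n) (hm : 1 ≤ m)
    {ψ : (Fin d → ℝ) → ℝ} (hψ : ContDiff ℝ r ψ)
    (hs : tsupport ψ ⊆ Metric.closedBall (fun _ => 1 / 2) (1 / 4))
    (hb : ∀ k ≤ r, ∀ t, ‖iteratedFDeriv ℝ k ψ t‖ ≤ 1) (hI : 0 < ∫ t, ψ t)
    {ι : Type*} [Fintype ι] [DecidableEq ι] [Nonempty ι] (hcard : Fintype.card ι ≤ m ^ d)
    {x : ι → X} (hx : ∀ i, ‖x i‖ ≤ 1) {K : ℝ}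
    (hK : ∀ J : Finset ι, J.card ≤ 2 * n → radMean (fun i : J => x i) ≤ K) :
    ENNReal.ofReal ((((m : ℝ) ^ (r + d))⁻¹ * ∫ t, ψ t) * (radMean x - K)) ≤
      2 * ranMinError.{u, v} d X r n := by
  set γ : ℝ := ((m : ℝ) ^ (r + d))⁻¹ * ∫ t, ψ t with hγ
  have hm' : (0 : ℝ) < m := by exact_mod_cast hm
  have hγ0 : 0 < γ := by positivity
  obtain ⟨e⟩ : Nonempty (ι ↪ (Fin d → Fin m)) :=
    Function.Embedding.nonempty_of_card_le (by simpa using hcard)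
  obtain ⟨cell, hcell⟩ := exists_cell (r := r) hs e.injective x
  have key : ∀ (Ω : Type v) (_ : MeasurableSpace Ω) (P : Measure Ω) (A : Ω → DetAlg d X),
      IsRandAlg r n P A → ENNReal.ofReal (γ * (radMean x - K)) ≤ 2 * randError r P A := by
    intro Ω _ P A hA
    have h := radMean_sub_le_randError hn hA cell (fooling ψ r m e x) hcell
      (fooling_mem_crBall hψ hs hb hm e.injective hx) (fun i => γ • x i)
      (integralOp_fooling hψ hs hm e x) (K := γ * K) (by
        intro J hJ
        rw [radMean_smul γ (fun i : J => x i), abs_of_pos hγ0]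
        exact mul_le_mul_of_nonneg_left (hK J hJ) hγ0.le)
    rwa [radMean_smul, abs_of_pos hγ0, ← mul_sub] at h
  have h2 : ENNReal.ofReal (γ * (radMean x - K)) / 2 ≤ ranMinError.{u, v} d X r n := by
    refine le_iInf fun Ω => le_iInf fun hΩ => le_iInf fun P => le_iInf fun A => le_iInf fun hA => ?_
    exact ENNReal.div_le_of_le_mul' (key Ω hΩ P A hA)
  rw [ENNReal.div_le_iff_le_mul (Or.inl two_ne_zero) (Or.inl ENNReal.ofNat_ne_top)] at h2
  exact h2.trans_eq (mul_comm _ _)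

/-- The rate `n^{-r/d-1+1/p}` of the minimal errors implies that Rademacher averages of `N` vectors
of the unit ball are of order `N^{1/p}`. The lower bound reduces the averages over `N` indices
to those over at most `N / 2`, and the losses form a geometric series. -/
lemma radMean_le_of_ranMinError_le {d r : ℕ} (hd : 1 ≤ d) {p : ℝ} (hp1 : 1 ≤ p) (hp2 : p ≤ 2)
    {c : ℝ} (hc : 0 < c) (h : ∀ n : ℕ, 1 ≤ n → ranMinError.{u, v} d X r n ≤
      ENNReal.ofReal (c * (n : ℝ) ^ (-(r : ℝ) / (d : ℝ) - 1 + 1 / p))) :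
    ∃ C : ℝ, 0 ≤ C ∧ ∀ (N : ℕ) (ι : Type) [Fintype ι] [DecidableEq ι], Fintype.card ι ≤ N →
      ∀ x : ι → X, (∀ i, ‖x i‖ ≤ 1) → radMean x ≤ C * (N : ℝ) ^ (1 / p) := by
  have hp0 : 0 < p := by linarith
  have hd0 : (0 : ℝ) < d := by exact_mod_cast hd
  obtain ⟨ψ, hψ, hs, hb, hI⟩ := exists_bump d r
  set I := ∫ t, ψ t with hIdef
  set e : ℝ := -(r : ℝ) / (d : ℝ) - 1 + 1 / p with he
  have he0 : e ≤ 0 := by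
    have h1 : 1 / p ≤ 1 := by rw [div_le_one hp0]; exact hp1
    have h2 : -(r : ℝ) / (d : ℝ) ≤ 0 := by
      rw [neg_div]; exact neg_nonpos.2 (by positivity)
    linarith
  set C₀ : ℝ := 2 * c * (1 / 8 : ℝ) ^ e * 2 ^ (r + d) / I with hC₀
  have hC₀0 : 0 ≤ C₀ := by positivity
  refine ⟨4 * C₀ + 4, by linarith, fun N => ?_⟩
  induction N using Nat.strong_induction_on with
  | _ N ih =>
  intro ι _ _ hcard x hx
  have hR := radMean_le_card x hx
  have hcardR : (Fintype.card ι : ℝ) ≤ N := by exact_mod_cast hcard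
  rcases Nat.lt_or_ge N 4 with hN4 | hN4
  · rcases Nat.eq_zero_or_pos N with rfl | hN0
    · have : (0 : ℝ) ≤ (4 * C₀ + 4) * ((0 : ℕ) : ℝ) ^ (1 / p) := by positivity
      simp only [Nat.cast_zero] at hcardR this ⊢
      linarith
    · have h1 : (1 : ℝ) ≤ (N : ℝ) ^ (1 / p) :=
        Real.one_le_rpow (by exact_mod_cast hN0) (by positivity)
      have h2 : (N : ℝ) ≤ 4 := by exact_mod_cast hN4.le
      nlinarith
  rcases isEmpty_or_nonempty ι with hι | hι
  · rw [Fintype.card_eq_zero, Nat.cast_zero] at hR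
    exact hR.trans (by positivity)
  have hNpos : (0 : ℝ) < N := by exact_mod_cast (by omega : 0 < N)
  obtain ⟨m, hm, hNm, hm2⟩ := exists_pow_ge hd (by omega : 1 ≤ N)
  -- With `n = N / 4` the sets of at most `2 n` seen indices are covered by the induction hypothesis.
  set n := N / 4 with hn
  have hn1 : 1 ≤ n := by omega
  have hNn : (N : ℝ) / 8 ≤ n := by
    have : N ≤ 8 * n := by omega
    have : (N : ℝ) ≤ 8 * n := by exact_mod_cast this
    linarith
  set K : ℝ := (4 * C₀ + 4) * ((2 * n : ℕ) : ℝ) ^ (1 / p) with hK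
  have hlow := radMean_sub_le_ranMinError.{u, v} (r := r) hn1 hm hψ hs hb hI
    (hcard.trans hNm) hx (K := K) (fun J hJ => ih (2 * n) (by omega) J (by simpa using hJ) _
      fun i => hx i)
  have hm' : (0 : ℝ) < m := by exact_mod_cast hm
  have h1 : ((m : ℝ) ^ (r + d))⁻¹ * I * (radMean x - K) ≤ 2 * (c * (n : ℝ) ^ e) := by
    have h2 := hlow.trans (mul_le_mul_right (h n hn1) 2)
    rw [← ENNReal.ofReal_ofNat 2, ← ENNReal.ofReal_mul (by norm_num)] at h2
    exact (ENNReal.ofReal_le_ofReal_iff (by positivity)).1 h2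
  have h3 : radMean x - K ≤ 2 * (c * (n : ℝ) ^ e) * (m : ℝ) ^ (r + d) / I := by
    rw [le_div_iff₀ hI]
    have h4 : (radMean x - K) * I =
        (((m : ℝ) ^ (r + d))⁻¹ * I * (radMean x - K)) * (m : ℝ) ^ (r + d) := by
      field_simp
    rw [h4]
    exact mul_le_mul_of_nonneg_right h1 (by positivity)
  have h5 : (n : ℝ) ^ e ≤ (1 / 8 : ℝ) ^ e * (N : ℝ) ^ e := by
    rw [← Real.mul_rpow (by norm_num) hNpos.le]
    exact Real.rpow_le_rpow_of_nonpos (by positivity) (by linarith) he0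
  have h6 : (m : ℝ) ^ (r + d) ≤ 2 ^ (r + d) * (N : ℝ) ^ (((r : ℝ) + d) / d) := by
    refine (pow_le_pow_left₀ hm'.le hm2 _).trans (le_of_eq ?_)
    rw [mul_pow, ← Real.rpow_natCast ((N : ℝ) ^ (1 / (d : ℝ))), ← Real.rpow_mul hNpos.le]
    congr 2
    push_cast
    ring
  have h7 : (N : ℝ) ^ e * (N : ℝ) ^ (((r : ℝ) + d) / d) = (N : ℝ) ^ (1 / p) := by
    rw [← Real.rpow_add hNpos]
    congr 1
    rw [he]; field_simp; ring
  have h8 : 2 * (c * (n : ℝ) ^ e) * (m : ℝ) ^ (r + d) / I ≤ C₀ * (N : ℝ) ^ (1 / p) := by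
    calc 2 * (c * (n : ℝ) ^ e) * (m : ℝ) ^ (r + d) / I
        ≤ 2 * (c * ((1 / 8 : ℝ) ^ e * (N : ℝ) ^ e)) *
          (2 ^ (r + d) * (N : ℝ) ^ (((r : ℝ) + d) / d)) / I := by gcongr
      _ = C₀ * ((N : ℝ) ^ e * (N : ℝ) ^ (((r : ℝ) + d) / d)) := by rw [hC₀]; ring
      _ = _ := by rw [h7]
  -- The ratio of the geometric series: `p ≤ 2` gives `(1 / 2) ^ (1 / p) ≤ 3 / 4`.
  have h9 : ((2 * n : ℕ) : ℝ) ^ (1 / p) ≤ 3 / 4 * (N : ℝ) ^ (1 / p) := by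
    have h10 : ((2 * n : ℕ) : ℝ) ≤ 1 / 2 * N := by
      have : 2 * (2 * n) ≤ N := by omega
      have : (2 : ℝ) * ((2 * n : ℕ) : ℝ) ≤ N := by exact_mod_cast this
      linarith
    have h11 : (1 / 2 : ℝ) ^ (1 / p) ≤ 3 / 4 := by
      calc (1 / 2 : ℝ) ^ (1 / p) ≤ (1 / 2 : ℝ) ^ (1 / 2 : ℝ) := by
            refine Real.rpow_le_rpow_of_exponent_ge (by norm_num) (by norm_num) ?_
            exact one_div_le_one_div_of_le hp0 hp2
        _ ≤ 3 / 4 := by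
            rw [← Real.sqrt_eq_rpow, Real.sqrt_le_left (by norm_num)]
            norm_num
    calc ((2 * n : ℕ) : ℝ) ^ (1 / p) ≤ (1 / 2 * (N : ℝ)) ^ (1 / p) :=
          Real.rpow_le_rpow (by positivity) h10 (by positivity)
      _ = (1 / 2 : ℝ) ^ (1 / p) * (N : ℝ) ^ (1 / p) := Real.mul_rpow (by norm_num) hNpos.le
      _ ≤ _ := by gcongr
  have h12 : K ≤ (4 * C₀ + 4) * (3 / 4 * (N : ℝ) ^ (1 / p)) := by
    rw [hK]; gcongr
  have h13 : (0 : ℝ) ≤ (N : ℝ) ^ (1 / p) := by positivity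
  nlinarith

theorem isEqualNormType_of_ranMinError_le {d r : ℕ} (hd : 1 ≤ d) {p : ℝ} (hp1 : 1 ≤ p)
    (hp2 : p ≤ 2) {c : ℝ} (hc : 0 < c) (h : ∀ n : ℕ, 1 ≤ n → ranMinError.{u, v} d X r n ≤
      ENNReal.ofReal (c * (n : ℝ) ^ (-(r : ℝ) / (d : ℝ) - 1 + 1 / p))) :
    IsEqualNormType X p := by
  obtain ⟨C, hC, hR⟩ := radMean_le_of_ranMinError_le.{u, v} hd hp1 hp2 hc h
  exact isEqualNormType_of_radMean_le hp1 hp2 hC fun n x hx => hR n (Fin n) (by simp) x hx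

/-! ### Monte Carlo integration of vector valued functions -/

section Symmetrization

variable {X : Type u} [NormedAddCommGroup X] [NormedSpace ℝ X]
  {T : Type*} [MeasurableSpace T] {μ : Measure T} [IsProbabilityMeasure μ]

/-- Exchanging the two components where the sign is `-1`. -/
def swapBy (s : ℤˣ) (q : T × T) : T × T := if s = 1 then q else q.swap

lemma measurePreserving_swapBy (s : ℤˣ) :
    MeasurePreserving (swapBy s) (μ.prod μ) (μ.prod μ) := by
  by_cases h : s = 1
  · have : (swapBy s : T × T → T × T) = id := by ext q <;> simp [swapBy, h]
    rw [this]
    exact MeasurePreserving.id _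
  · have : (swapBy s : T × T → T × T) = Prod.swap := by ext q <;> simp [swapBy, h]
    rw [this]
    exact Measure.measurePreserving_swap

omit [NormedSpace ℝ X] [MeasurableSpace T] in
lemma sub_swapBy (s : ℤˣ) (g : T → X) (q : T × T) :
    g (swapBy s q).1 - g (swapBy s q).2 = (s : ℤ) • (g q.1 - g q.2) := by
  rcases Int.units_eq_one_or s with rfl | rfl
  · simp [swapBy]
  · simp [swapBy, show ((-1 : ℤˣ) = 1) = False by decide]

variable {n : ℕ} {g : T → X} {δ : ℝ}

/-- Symmetrization, for a sample of pairs: independent copies may be exchanged at random. -/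
lemma integral_pairs_le (hg : StronglyMeasurable g) (hδ : ∀ t, ‖g t‖ ≤ δ) {B : ℝ}
    (hB : ∀ x : Fin n → X, (∀ i, ‖x i‖ ≤ δ) → radMean x ≤ B) :
    ∫ q : Fin n → T × T, ‖∑ i, (g (q i).1 - g (q i).2)‖ ∂Measure.pi (fun _ => μ.prod μ) ≤
      2 * B := by
  set ν : Measure (Fin n → T × T) := Measure.pi (fun _ => μ.prod μ) with hν
  set F : (Fin n → ℤˣ) → (Fin n → T × T) → ℝ :=
    fun ε q => ‖radSum ε fun i => g (q i).1 - g (q i).2‖ with hF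
  have hgm : ∀ i, StronglyMeasurable fun q : Fin n → T × T => g (q i).1 - g (q i).2 := fun i =>
    (hg.comp_measurable (measurable_fst.comp (measurable_pi_apply i))).sub
      (hg.comp_measurable (measurable_snd.comp (measurable_pi_apply i)))
  have hFm : ∀ ε, StronglyMeasurable (F ε) := by
    intro ε
    refine StronglyMeasurable.norm ?_
    unfold radSum
    refine Finset.stronglyMeasurable_fun_sum _ fun i _ => ?_
    simp only [← Int.cast_smul_eq_zsmul ℝ]
    exact (hgm i).const_smul _
  have hFi : ∀ ε, Integrable (F ε) ν := by
    intro ε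
    refine Integrable.of_bound (hFm ε).aestronglyMeasurable (∑ _i : Fin n, (δ + δ))
      (Filter.Eventually.of_forall fun q => ?_)
    rw [hF, norm_norm]
    exact (norm_radSum_le _ _).trans (Finset.sum_le_sum fun i _ =>
      (norm_sub_le _ _).trans (add_le_add (hδ _) (hδ _)))
  have hinv : ∀ ε, ∫ q, F ε q ∂ν = ∫ q, F 1 q ∂ν := by
    intro ε
    have hmp : MeasurePreserving (fun (q : Fin n → T × T) i => swapBy (ε i) (q i)) ν ν :=
      measurePreserving_pi _ _ fun i => measurePreserving_swapBy (ε i)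
    have h := integral_map (μ := ν) hmp.measurable.aemeasurable (f := F 1)
      (by rw [hmp.map_eq]; exact (hFm 1).aestronglyMeasurable)
    rw [hmp.map_eq] at h
    rw [h]
    refine integral_congr_ae (Filter.Eventually.of_forall fun q => ?_)
    simp only [hF, sub_swapBy, radSum, Pi.one_apply, Units.val_one, one_smul]
  have h1 : ∫ q, F 1 q ∂ν = ∫ q, 𝔼 ε, F ε q ∂ν := by
    simp only [Fintype.expect_eq_sum_div_card]
    rw [integral_div, integral_finsetSum _ fun ε _ => hFi ε, Finset.sum_congr rfl fun ε _ => hinv ε,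
      Finset.sum_const, Finset.card_univ, nsmul_eq_mul, mul_div_cancel_left₀]
    exact_mod_cast Fintype.card_ne_zero
  have h2 : ∀ q, 𝔼 ε, F ε q ≤ 2 * B := by
    intro q
    have h3 : 𝔼 ε, F ε q ≤ radMean (fun i => g (q i).1) + radMean (fun i => g (q i).2) := by
      rw [radMean, radMean, ← Finset.expect_add_distrib]
      refine Finset.expect_le_expect fun ε _ => ?_
      refine le_trans (le_of_eq ?_) (norm_sub_le _ _)
      simp only [hF, radSum, smul_sub, Finset.sum_sub_distrib]
    have h4 := hB (fun i => g (q i).1) fun i => hδ _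
    have h5 := hB (fun i => g (q i).2) fun i => hδ _
    linarith
  have h6 : ∫ q, F 1 q ∂ν ≤ 2 * B := by
    rw [h1]
    refine (integral_mono_of_nonneg (Filter.Eventually.of_forall fun q =>
      Finset.expect_nonneg fun ε _ => norm_nonneg _) (integrable_const (2 * B))
      (Filter.Eventually.of_forall h2)).trans (le_of_eq ?_)
    simp
  simpa [hF, radSum] using h6

variable [CompleteSpace X]

/-- The Monte Carlo error of a bounded function is controlled by Rademacher averages of vectors of
its range. -/
lemma integral_norm_sum_sub_le (hg : StronglyMeasurable g) (hδ : ∀ t, ‖g t‖ ≤ δ) {B : ℝ}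
    (hB : ∀ x : Fin n → X, (∀ i, ‖x i‖ ≤ δ) → radMean x ≤ B) :
    ∫ ω : Fin n → T, ‖∑ i, g (ω i) - (n : ℝ) • ∫ t, g t ∂μ‖ ∂Measure.pi (fun _ => μ) ≤ 2 * B := by
  set ρ : Measure (Fin n → T) := Measure.pi (fun _ => μ) with hρ
  have hgi : ∀ i : Fin n, StronglyMeasurable fun ω : Fin n → T => g (ω i) := fun i =>
    hg.comp_measurable (measurable_pi_apply i)
  have hint : ∀ i : Fin n, Integrable (fun ω : Fin n → T => g (ω i)) ρ := fun i =>
    Integrable.of_bound (hgi i).aestronglyMeasurable δ (Filter.Eventually.of_forall fun _ => hδ _)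
  have heval : ∀ i : Fin n, ∫ ω, g (ω i) ∂ρ = ∫ t, g t ∂μ := by
    intro i
    have hmp := measurePreserving_eval (fun _ : Fin n => μ) i
    rw [← hmp.map_eq, integral_map hmp.measurable.aemeasurable
      (by rw [hmp.map_eq]; exact hg.aestronglyMeasurable)]
  have h1 : ∀ ω : Fin n → T, ∑ i, g (ω i) - (n : ℝ) • ∫ t, g t ∂μ =
      ∫ ω', ∑ i, (g (ω i) - g (ω' i)) ∂ρ := by
    intro ω
    have hi : ∀ i ∈ Finset.univ, Integrable (fun ω' : Fin n → T => g (ω i) - g (ω' i)) ρ :=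
      fun i _ => (integrable_const _).sub (hint i)
    rw [integral_finsetSum _ hi]
    simp only [integral_sub (integrable_const _) (hint _), heval, integral_const, Measure.real,
      measure_univ, ENNReal.toReal_one, one_smul, Finset.sum_sub_distrib, Finset.sum_const,
      Finset.card_univ, Fintype.card_fin]
    rw [Nat.cast_smul_eq_nsmul]
  set H : (Fin n → T) × (Fin n → T) → ℝ := fun q => ‖∑ i, (g (q.1 i) - g (q.2 i))‖ with hH
  have hHm : StronglyMeasurable H := by
    refine StronglyMeasurable.norm (Finset.stronglyMeasurable_fun_sum _ fun i _ => ?_)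
    exact ((hgi i).comp_measurable measurable_fst).sub ((hgi i).comp_measurable measurable_snd)
  have hHi : Integrable H (ρ.prod ρ) := by
    refine Integrable.of_bound hHm.aestronglyMeasurable (∑ _i : Fin n, (δ + δ))
      (Filter.Eventually.of_forall fun q => ?_)
    rw [hH, norm_norm]
    exact (norm_sum_le _ _).trans (Finset.sum_le_sum fun i _ =>
      (norm_sub_le _ _).trans (add_le_add (hδ _) (hδ _)))
  have h2 : ∫ q, H q ∂(ρ.prod ρ) = ∫ q : Fin n → T × T, ‖∑ i, (g (q i).1 - g (q i).2)‖
      ∂Measure.pi (fun _ => μ.prod μ) :=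
    ((measurePreserving_arrowProdEquivProdArrow T T (Fin n) (fun _ => μ)
      (fun _ => μ)).integral_comp' H).symm
  calc ∫ ω : Fin n → T, ‖∑ i, g (ω i) - (n : ℝ) • ∫ t, g t ∂μ‖ ∂ρ
      ≤ ∫ ω, ∫ ω', H (ω, ω') ∂ρ ∂ρ := by
        refine integral_mono_of_nonneg (Filter.Eventually.of_forall fun _ => norm_nonneg _)
          hHi.integral_prod_left (Filter.Eventually.of_forall fun ω => ?_)
        simp only [h1]
        exact norm_integral_le_integral_norm _
    _ = ∫ q, H q ∂(ρ.prod ρ) := (integral_prod H hHi).symm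
    _ ≤ 2 * B := by rw [h2]; exact integral_pairs_le hg hδ hB

end Symmetrization

/-! ### Piecewise polynomial interpolation -/

section Interpolation

variable {X : Type u} [NormedAddCommGroup X] [NormedSpace ℝ X]

/-- Lagrange interpolation reproduces the powers below the number of nodes. -/
lemma sum_lagrange_basis_mul_pow {r : ℕ} {v : Fin r → ℝ} (hv : Function.Injective v) {q : ℕ}
    (hq : q < r) (s : ℝ) :
    ∑ j, (Lagrange.basis Finset.univ v j).eval s * v j ^ q = s ^ q := by
  have h := Lagrange.eq_interpolate (s := Finset.univ) (v := v) (f := Polynomial.X ^ q)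
    hv.injOn (by
      rw [Polynomial.degree_X_pow, Finset.card_univ, Fintype.card_fin]; exact_mod_cast hq)
  have h' := congrArg (Polynomial.eval s) h
  rw [Lagrange.interpolate_apply, Polynomial.eval_finsetSum] at h'
  simp only [Polynomial.eval_mul, Polynomial.eval_C, Polynomial.eval_pow, Polynomial.eval_X] at h'
  rw [h']
  exact Finset.sum_congr rfl fun j _ => mul_comm _ _

/-- The Taylor formula on a subinterval, for functions with `r`-th derivative bounded by `1`. -/
lemma exists_taylor_bound {r : ℕ} (hr : 1 ≤ r) {g : ℝ → X}
    (hg : ContDiffOn ℝ r g (Set.Icc 0 1))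
    (hb : ∀ y ∈ Set.Icc (0 : ℝ) 1, ‖iteratedDerivWithin r g (Set.Icc 0 1) y‖ ≤ 1)
    {a : ℝ} (ha0 : 0 ≤ a) (ha1 : a < 1) :
    ∃ c : ℕ → X, ∀ x ∈ Set.Icc a 1,
      ‖g x - ∑ q ∈ Finset.range r, (x - a) ^ q • c q‖ ≤ (x - a) ^ r := by
  obtain ⟨n, rfl⟩ : ∃ n, r = n + 1 := ⟨r - 1, by omega⟩
  have hsub : Set.Icc a 1 ⊆ Set.Icc (0 : ℝ) 1 := Set.Icc_subset_Icc_left ha0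
  refine ⟨fun q => ((q.factorial : ℝ))⁻¹ • iteratedDerivWithin q g (Set.Icc a 1) a,
    fun x hx => ?_⟩
  have h := taylor_mean_remainder_bound (f := g) (n := n) (C := 1) ha1.le
    (by exact_mod_cast hg.mono hsub) hx (by
      intro y hy
      have h1 : iteratedDerivWithin (n + 1) g (Set.Icc a 1) y =
          iteratedDerivWithin (n + 1) g (Set.Icc 0 1) y := by
        rw [iteratedDerivWithin, iteratedDerivWithin, iteratedFDerivWithin_subset hsub
          (uniqueDiffOn_Icc ha1) (uniqueDiffOn_Icc zero_lt_one) (by exact_mod_cast hg) hy]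
      rw [h1]
      exact hb y (hsub hy))
  rw [taylor_within_apply] at h
  have h2 : ∑ q ∈ Finset.range (n + 1), (x - a) ^ q •
      ((q.factorial : ℝ))⁻¹ • iteratedDerivWithin q g (Set.Icc a 1) a =
      ∑ q ∈ Finset.range (n + 1), (((q.factorial : ℝ))⁻¹ * (x - a) ^ q) •
        iteratedDerivWithin q g (Set.Icc a 1) a :=
    Finset.sum_congr rfl fun q _ => by rw [smul_smul, mul_comm]
  rw [h2]
  refine h.trans ?_
  rw [one_mul]
  exact div_le_self (pow_nonneg (by linarith [hx.1]) _)
    (by exact_mod_cast Nat.one_le_iff_ne_zero.2 (Nat.factorial_ne_zero n))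

variable (X) in
/-- Piecewise Lagrange interpolation of order `r` on `k` intervals, in terms of nodes `z` and
weights `w`: uniformly bounded, and with an error of order `k ^ (-r)`. -/
lemma exists_interpolation_interval (r : ℕ) : ∃ L : ℝ, 1 ≤ L ∧ ∀ k : ℕ, 1 ≤ k →
    ∃ (z : Fin k × Fin r → ℝ) (w : Fin k × Fin r → ℝ → ℝ),
      (∀ j, z j ∈ Set.Icc (0 : ℝ) 1) ∧ (∀ j, Measurable (w j)) ∧
      (∀ s ∈ Set.Icc (0 : ℝ) 1, ∑ j, |w j s| ≤ L) ∧
      ∀ g : ℝ → X, ContDiffOn ℝ r g (Set.Icc 0 1) →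
        (∀ y ∈ Set.Icc (0 : ℝ) 1, ‖iteratedDerivWithin r g (Set.Icc 0 1) y‖ ≤ 1) →
        ∀ s ∈ Set.Icc (0 : ℝ) 1, ‖g s - ∑ j, w j s • g (z j)‖ ≤ (1 + L) * ((k : ℝ) ^ r)⁻¹ := by
  rcases Nat.eq_zero_or_pos r with rfl | hr
  · refine ⟨1, le_rfl, fun k _ => ⟨fun _ => 0, fun _ _ => 0, fun j => j.2.elim0,
      fun j => j.2.elim0, by simp, fun g _ hb s hs => ?_⟩⟩
    have := hb s hs
    rw [iteratedDerivWithin_zero] at this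
    simp only [Finset.univ_eq_empty, Finset.sum_empty, sub_zero, pow_zero]
    linarith
  have hr0 : (0 : ℝ) < r := by exact_mod_cast hr
  set v : Fin r → ℝ := fun j => ((j : ℕ) : ℝ) / r with hv
  have hvinj : Function.Injective v := by
    intro i j hij
    have h1 : ((i : ℕ) : ℝ) / r = ((j : ℕ) : ℝ) / r := hij
    rw [div_left_inj' hr0.ne'] at h1
    exact Fin.ext (by exact_mod_cast h1)
  have hv01 : ∀ j, v j ∈ Set.Icc (0 : ℝ) 1 := by
    intro j
    refine ⟨by positivity, ?_⟩
    rw [hv]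
    simp only
    rw [div_le_one hr0]
    exact_mod_cast j.isLt.le
  set B : Fin r → ℝ → ℝ := fun j s => (Lagrange.basis Finset.univ v j).eval s with hB
  have hBc : ∀ j, Continuous (B j) := fun j => Polynomial.continuous _
  have hbd : ∀ j, ∃ C, ∀ s ∈ Set.Icc (0 : ℝ) 1, ‖B j s‖ ≤ C := fun j =>
    isCompact_Icc.exists_bound_of_continuousOn (hBc j).continuousOn
  choose C hC using hbd
  set L := 1 + ∑ j, |C j| with hL
  have hL1 : 1 ≤ L := le_add_of_nonneg_right (Finset.sum_nonneg fun _ _ => abs_nonneg _)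
  have hBL : ∀ s ∈ Set.Icc (0 : ℝ) 1, ∑ j, |B j s| ≤ L := by
    intro s hs
    have : ∑ j, |B j s| ≤ ∑ j, |C j| :=
      Finset.sum_le_sum fun j _ => (hC j s hs).trans (le_abs_self _)
    linarith
  refine ⟨L, hL1, fun k hk => ?_⟩
  have hk0 : (0 : ℝ) < k := by exact_mod_cast hk
  -- The interval containing `s`; the minimum puts the right end point into the last one.
  set cell : ℝ → ℕ := fun s => min ⌊(k : ℝ) * s⌋₊ (k - 1) with hcell
  have hcm : Measurable cell := by
    have h1 : Measurable fun s : ℝ => ⌊(k : ℝ) * s⌋₊ :=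
      Nat.measurable_floor.comp (measurable_id.const_mul (k : ℝ))
    exact h1.min measurable_const
  have hcell_lt : ∀ s, cell s < k := fun s => (min_le_right _ _).trans_lt (by omega)
  have hcell_u : ∀ s ∈ Set.Icc (0 : ℝ) 1, (k : ℝ) * s - cell s ∈ Set.Icc (0 : ℝ) 1 := by
    intro s hs
    have hks : 0 ≤ (k : ℝ) * s := mul_nonneg hk0.le hs.1
    have hks1 : (k : ℝ) * s ≤ k := mul_le_of_le_one_right hk0.le hs.2
    constructor
    · have h1 : ((cell s : ℕ) : ℝ) ≤ (⌊(k : ℝ) * s⌋₊ : ℕ) := by exact_mod_cast min_le_left _ _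
      have h2 := Nat.floor_le hks
      linarith
    · rcases le_total ⌊(k : ℝ) * s⌋₊ (k - 1) with h | h
      · have h1 : cell s = ⌊(k : ℝ) * s⌋₊ := min_eq_left h
        rw [h1]
        linarith [Nat.lt_floor_add_one ((k : ℝ) * s)]
      · have h1 : cell s = k - 1 := min_eq_right h
        rw [h1, Nat.cast_sub hk]
        push_cast
        linarith
  refine ⟨fun q => (((q.1 : ℕ) : ℝ) + v q.2) / k,
    fun q s => if cell s = (q.1 : ℕ) then B q.2 ((k : ℝ) * s - (q.1 : ℕ)) else 0, ?_, ?_, ?_, ?_⟩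
  · intro q
    have h1 : ((q.1 : ℕ) : ℝ) + 1 ≤ k := by exact_mod_cast q.1.isLt
    have h2 := hv01 q.2
    refine ⟨div_nonneg (add_nonneg (by positivity) h2.1) hk0.le, ?_⟩
    rw [div_le_one hk0]
    linarith [h2.2]
  · intro q
    refine Measurable.ite (measurableSet_eq_fun hcm measurable_const) ?_ measurable_const
    exact (hBc q.2).measurable.comp ((measurable_id.const_mul (k : ℝ)).sub_const _)
  · intro s hs
    rw [Fintype.sum_prod_type, Finset.sum_eq_single (⟨cell s, hcell_lt s⟩ : Fin k)]
    · simpa using hBL _ (hcell_u s hs)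
    · intro a _ ha
      refine Finset.sum_eq_zero fun j _ => ?_
      dsimp only
      rw [if_neg fun h => ha (Fin.ext h.symm), abs_zero]
    · exact fun h => (h (Finset.mem_univ _)).elim
  · intro g hg hb s hs
    set a : ℝ := (cell s : ℕ) / k with ha
    set t : ℝ := (k : ℝ) * s - cell s with ht
    have ht01 : t ∈ Set.Icc (0 : ℝ) 1 := hcell_u s hs
    have hcs : ((cell s : ℕ) : ℝ) + 1 ≤ k := by exact_mod_cast hcell_lt s
    have ha1 : a < 1 := by rw [ha, div_lt_one hk0]; linarith
    have ha0 : 0 ≤ a := by positivity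
    obtain ⟨c, hc⟩ := exists_taylor_bound hr hg hb ha0 ha1
    have hpt : ∀ τ ∈ Set.Icc (0 : ℝ) 1, ((cell s : ℕ) + τ) / k ∈ Set.Icc a 1 ∧
        ((cell s : ℕ) + τ) / k - a = τ / k := by
      intro τ hτ
      refine ⟨⟨?_, ?_⟩, ?_⟩
      · rw [ha]; gcongr; linarith [hτ.1]
      · rw [div_le_one hk0]; linarith [hτ.2]
      · rw [ha]; ring
    have hTay : ∀ τ ∈ Set.Icc (0 : ℝ) 1, ‖g (((cell s : ℕ) + τ) / k) -
        ∑ q ∈ Finset.range r, (τ / k) ^ q • c q‖ ≤ ((k : ℝ) ^ r)⁻¹ := by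
      intro τ hτ
      have h1 := hc _ (hpt τ hτ).1
      rw [(hpt τ hτ).2] at h1
      refine h1.trans ?_
      rw [div_pow, div_eq_mul_inv]
      exact mul_le_of_le_one_left (by positivity) (pow_le_one₀ hτ.1 hτ.2)
    have hs' : s = ((cell s : ℕ) + t) / k := by
      rw [ht]; field_simp; ring
    have hsum : ∑ q : Fin k × Fin r, (if cell s = (q.1 : ℕ) then
        B q.2 ((k : ℝ) * s - (q.1 : ℕ)) else 0) • g ((((q.1 : ℕ) : ℝ) + v q.2) / k) =
        ∑ j, B j t • g (((cell s : ℕ) + v j) / k) := by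
      rw [Fintype.sum_prod_type, Finset.sum_eq_single (⟨cell s, hcell_lt s⟩ : Fin k)]
      · simp [ht]
      · intro b _ hb'
        refine Finset.sum_eq_zero fun j _ => ?_
        rw [if_neg fun h => hb' (Fin.ext h.symm), zero_smul]
      · exact fun h => (h (Finset.mem_univ _)).elim
    have hrep : ∑ j, B j t • ∑ q ∈ Finset.range r, (v j / k) ^ q • c q =
        ∑ q ∈ Finset.range r, (t / k) ^ q • c q := by
      simp only [Finset.smul_sum]
      rw [Finset.sum_comm]
      refine Finset.sum_congr rfl fun q hq => ?_
      simp only [smul_smul]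
      rw [← Finset.sum_smul]
      congr 1
      rw [div_pow, ← sum_lagrange_basis_mul_pow hvinj (Finset.mem_range.1 hq) t, Finset.sum_div]
      refine Finset.sum_congr rfl fun j _ => ?_
      rw [div_pow, mul_div_assoc]
    rw [hsum]
    have hdec : g s - ∑ j, B j t • g (((cell s : ℕ) + v j) / k) =
        (g (((cell s : ℕ) + t) / k) - ∑ q ∈ Finset.range r, (t / k) ^ q • c q) -
        ∑ j, B j t • (g (((cell s : ℕ) + v j) / k) -
          ∑ q ∈ Finset.range r, (v j / k) ^ q • c q) := by
      simp only [smul_sub, Finset.sum_sub_distrib]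
      rw [hrep, ← hs']
      abel
    rw [hdec]
    refine (norm_sub_le _ _).trans ?_
    rw [add_mul, one_mul]
    refine add_le_add (hTay t ht01) ?_
    refine (norm_sum_le _ _).trans ?_
    calc ∑ j, ‖B j t • (g (((cell s : ℕ) + v j) / k) -
          ∑ q ∈ Finset.range r, (v j / k) ^ q • c q)‖ ≤ ∑ j, |B j t| * ((k : ℝ) ^ r)⁻¹ := by
          refine Finset.sum_le_sum fun j _ => ?_
          rw [norm_smul, Real.norm_eq_abs]
          exact mul_le_mul_of_nonneg_left (hTay _ (hv01 j)) (abs_nonneg _)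
      _ ≤ L * ((k : ℝ) ^ r)⁻¹ := by
          rw [← Finset.sum_mul]
          exact mul_le_mul_of_nonneg_right (hBL t ht01) (by positivity)

/-- Tensor products of one-dimensional interpolation: if interpolation in each single variable has
error at most `δ`, the error of interpolation in all variables is of the order `δ`. -/
lemma norm_sub_tensor_le {κ : Type} [Fintype κ] {z : κ → ℝ} (hz : ∀ j, z j ∈ Set.Icc (0 : ℝ) 1)
    {w : κ → ℝ → ℝ} {L : ℝ} (hL : 1 ≤ L) (hw : ∀ s ∈ Set.Icc (0 : ℝ) 1, ∑ j, |w j s| ≤ L)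
    {δ : ℝ} (hδ : 0 ≤ δ) (d : ℕ) : ∀ f : (Fin d → ℝ) → X,
    (∀ l, ∀ t ∈ cube d, ‖f t - ∑ j, w j (t l) • f (Function.update t l (z j))‖ ≤ δ) →
    ∀ t ∈ cube d, ‖f t - ∑ j : Fin d → κ, (∏ l, w (j l) (t l)) • f (fun l => z (j l))‖ ≤
      d * L ^ d * δ := by
  induction d with
  | zero =>
    intro f _ t _
    have : t = fun l => z ((Fin.elim0 : Fin 0 → κ) l) := Subsingleton.elim _ _
    simp [this, Subsingleton.elim _ (Fin.elim0 : Fin 0 → κ)]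
  | succ d ih =>
    intro f hf t ht
    obtain ⟨s, t', rfl⟩ : ∃ (s : ℝ) (t' : Fin d → ℝ), t = Fin.cons s t' :=
      ⟨t 0, Fin.tail t, (Fin.cons_self_tail t).symm⟩
    have hs : s ∈ Set.Icc (0 : ℝ) 1 := ⟨ht.1 0, ht.2 0⟩
    have ht' : t' ∈ cube d := ⟨fun l => ht.1 l.succ, fun l => ht.2 l.succ⟩
    have h0 := hf 0 _ ht
    simp only [Fin.cons_zero, Fin.update_cons_zero] at h0
    have hrec : ∀ m : κ, ‖f (Fin.cons (z m) t') - ∑ j : Fin d → κ, (∏ l, w (j l) (t' l)) •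
        f (Fin.cons (z m) fun l => z (j l))‖ ≤ d * L ^ d * δ := by
      intro m
      refine ih (fun y => f (Fin.cons (z m) y)) (fun l y hy => ?_) t' ht'
      have hy' : (Fin.cons (z m) y : Fin (d + 1) → ℝ) ∈ cube (d + 1) := by
        refine ⟨fun l => ?_, fun l => ?_⟩
        · refine Fin.cases ?_ (fun l => ?_) l
          · exact (hz m).1
          · exact hy.1 l
        · refine Fin.cases ?_ (fun l => ?_) l
          · exact (hz m).2
          · exact hy.2 l
      have h1 := hf l.succ _ hy'
      simp only [Fin.cons_succ, ← Fin.cons_update] at h1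
      exact h1
    have hsum : ∑ j : Fin (d + 1) → κ, (∏ l, w (j l) ((Fin.cons s t' : Fin (d + 1) → ℝ) l)) •
        f (fun l => z (j l)) = ∑ m, w m s • ∑ j : Fin d → κ, (∏ l, w (j l) (t' l)) •
          f (Fin.cons (z m) fun l => z (j l)) := by
      rw [← (Fin.consEquiv fun _ : Fin (d + 1) => κ).sum_comp, Fintype.sum_prod_type]
      refine Finset.sum_congr rfl fun m _ => ?_
      rw [Finset.smul_sum]
      refine Finset.sum_congr rfl fun j _ => ?_
      rw [smul_smul, Fin.prod_univ_succ]
      simp only [Fin.consEquiv_apply, Fin.cons_zero, Fin.cons_succ]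
      congr 2
      ext l
      refine Fin.cases ?_ (fun l => ?_) l <;> simp
    rw [hsum]
    have hdec : f (Fin.cons s t') - ∑ m, w m s • ∑ j : Fin d → κ, (∏ l, w (j l) (t' l)) •
          f (Fin.cons (z m) fun l => z (j l)) =
        (f (Fin.cons s t') - ∑ m, w m s • f (Fin.cons (z m) t')) +
        ∑ m, w m s • (f (Fin.cons (z m) t') - ∑ j : Fin d → κ, (∏ l, w (j l) (t' l)) •
          f (Fin.cons (z m) fun l => z (j l))) := by
      simp only [smul_sub, Finset.sum_sub_distrib]
      abel
    rw [hdec]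
    have hLd : 1 ≤ L ^ (d + 1) := one_le_pow₀ hL
    have h2 : ‖∑ m, w m s • (f (Fin.cons (z m) t') - ∑ j : Fin d → κ, (∏ l, w (j l) (t' l)) •
          f (Fin.cons (z m) fun l => z (j l)))‖ ≤ L * (d * L ^ d * δ) := by
      refine (norm_sum_le _ _).trans ?_
      calc _ ≤ ∑ m, |w m s| * (d * L ^ d * δ) := by
            refine Finset.sum_le_sum fun m _ => ?_
            rw [norm_smul, Real.norm_eq_abs]
            exact mul_le_mul_of_nonneg_left (hrec m) (abs_nonneg _)
        _ ≤ _ := by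
            rw [← Finset.sum_mul]
            exact mul_le_mul_of_nonneg_right (hw s hs) (by positivity)
    refine (norm_add_le _ _).trans ((add_le_add h0 h2).trans ?_)
    push_cast
    rw [pow_succ] at hLd ⊢
    nlinarith [mul_le_mul_of_nonneg_right hLd hδ]

end Interpolation

section Ball

variable {d r : ℕ} {X : Type u} [NormedAddCommGroup X] [NormedSpace ℝ X] {f : (Fin d → ℝ) → X}

lemma norm_partialDeriv_le (hf : f ∈ crBall d X r) {k : ℕ} (hk : k ≤ r) (i : Fin k → Fin d)
    {t : Fin d → ℝ} (ht : t ∈ cube d) : ‖partialDeriv i f t‖ ≤ 1 := by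
  have h := hf.2
  simp only [crNorm, iSup_le_iff] at h
  have := h k hk i t ht
  rwa [← ofReal_norm, ENNReal.ofReal_le_one] at this

lemma norm_le_one_of_mem_crBall (hf : f ∈ crBall d X r) {t : Fin d → ℝ} (ht : t ∈ cube d) :
    ‖f t‖ ≤ 1 := by
  simpa [partialDeriv] using norm_partialDeriv_le hf (Nat.zero_le r) Fin.elim0 ht

lemma update_mem_cube {t : Fin d → ℝ} (ht : t ∈ cube d) (l : Fin d) {s : ℝ}
    (hs : s ∈ Set.Icc (0 : ℝ) 1) : Function.update t l s ∈ cube d := by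
  constructor <;> intro j <;> by_cases h : j = l
  · subst h; simpa using hs.1
  · simpa [h] using ht.1 j
  · subst h; simpa using hs.2
  · simpa [h] using ht.2 j

lemma contDiffOn_comp_update (hf : f ∈ crBall d X r) {t : Fin d → ℝ} (ht : t ∈ cube d)
    (l : Fin d) : ContDiffOn ℝ r (fun s => f (Function.update t l s)) (Set.Icc 0 1) :=
  hf.1.comp (contDiff_update _ t l).contDiffOn fun _ hs => update_mem_cube ht l hs

/-- The derivatives of the restriction of `f` to a line parallel to a coordinate axis are partial
derivatives of `f`. -/
lemma iteratedDerivWithin_comp_update (hf : f ∈ crBall d X r) {t : Fin d → ℝ} (ht : t ∈ cube d)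
    (l : Fin d) {k : ℕ} (hk : k ≤ r) : ∀ s ∈ Set.Icc (0 : ℝ) 1,
    iteratedDerivWithin k (fun s => f (Function.update t l s)) (Set.Icc 0 1) s =
      partialDeriv (fun _ : Fin k => l) f (Function.update t l s) := by
  induction k with
  | zero => intro s _; simp [partialDeriv]
  | succ k ih =>
    intro s hs
    rw [iteratedDerivWithin_succ, derivWithin_congr (ih (by omega)) (ih (by omega) s hs)]
    have h1 : DifferentiableWithinAt ℝ (iteratedFDerivWithin ℝ k f (cube d)) (cube d)
        (Function.update t l s) :=
      hf.1.differentiableOn_iteratedFDerivWithin (by exact_mod_cast hk) (uniqueDiffOn_cube d) _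
        (update_mem_cube ht l hs)
    have h2 : HasDerivWithinAt (fun s => Function.update t l s) (Pi.single l (1 : ℝ))
        (Set.Icc 0 1) s := (hasDerivAt_update t l s).hasDerivWithinAt
    have h3 := h1.hasFDerivWithinAt.comp_hasDerivWithinAt s h2
      (fun _ hs => update_mem_cube ht l hs)
    have h4 := (ContinuousMultilinearMap.apply ℝ (fun _ : Fin k => Fin d → ℝ) X
      fun _ => Pi.single l 1).hasFDerivAt.comp_hasDerivWithinAt s h3
    refine (h4.derivWithin (uniqueDiffOn_Icc zero_lt_one s hs)).trans ?_
    rw [partialDeriv, iteratedFDerivWithin_succ_apply_left]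
    rfl

variable (d r X) in
/-- Interpolation on a grid of `(k r) ^ d` points: a linear method with measurable bounded weights
and error of order `k ^ (-r)` on the unit ball of `C^r`. -/
lemma exists_interpolation_cube : ∃ C : ℝ, 0 < C ∧ ∀ k : ℕ, 1 ≤ k →
    ∃ (y : (Fin d → Fin k × Fin r) → cube d) (W : (Fin d → Fin k × Fin r) → cube d → ℝ),
      (∀ j, Measurable (W j)) ∧ (∃ D, ∀ j t, |W j t| ≤ D) ∧
      ∀ f ∈ crBall d X r, ∀ t : cube d, ‖f t - ∑ j, W j t • f (y j)‖ ≤ C * ((k : ℝ) ^ r)⁻¹ := by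
  obtain ⟨L, hL, h⟩ := exists_interpolation_interval X r
  refine ⟨d * L ^ d * (1 + L) + 1, by positivity, fun k hk => ?_⟩
  obtain ⟨z, w, hz, hwm, hw, hint⟩ := h k hk
  have hcoord : ∀ (t : cube d) (l : Fin d), (t : Fin d → ℝ) l ∈ Set.Icc (0 : ℝ) 1 :=
    fun t l => ⟨t.2.1 l, t.2.2 l⟩
  refine ⟨fun j => ⟨fun l => z (j l), fun l => (hz (j l)).1, fun l => (hz (j l)).2⟩,
    fun j t => ∏ l, w (j l) ((t : Fin d → ℝ) l), fun j => ?_, ⟨L ^ d, fun j t => ?_⟩,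
    fun f hf t => ?_⟩
  · exact Finset.measurable_fun_prod _ fun l _ =>
      (hwm (j l)).comp ((measurable_pi_apply l).comp measurable_subtype_coe)
  · rw [Finset.abs_prod]
    refine (Finset.prod_le_prod (fun _ _ => abs_nonneg _) (g := fun _ => L) fun l _ => ?_).trans
      (by simp)
    exact (Finset.single_le_sum (f := fun j => |w j ((t : Fin d → ℝ) l)|)
      (fun _ _ => abs_nonneg _) (Finset.mem_univ (j l))).trans (hw _ (hcoord t l))
  · have h1 := norm_sub_tensor_le hz hL hw (δ := (1 + L) * ((k : ℝ) ^ r)⁻¹) (by positivity) d f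
      (fun l t ht => by
        have h2 := hint (fun s => f (Function.update t l s)) (contDiffOn_comp_update hf ht l)
          (fun s hs => by
            rw [iteratedDerivWithin_comp_update hf ht l le_rfl s hs]
            exact norm_partialDeriv_le hf le_rfl _ (update_mem_cube ht l hs))
          (t l) ⟨ht.1 l, ht.2 l⟩
        simpa using h2) t t.2
    refine h1.trans ?_
    have : 0 ≤ ((k : ℝ) ^ r)⁻¹ := by positivity
    nlinarith

end Ball

/-! ### The randomized algorithm -/

section Nonadaptive

variable {d : ℕ} {X : Type u}

lemma zero_mem_cube (d : ℕ) : (0 : Fin d → ℝ) ∈ cube d := ⟨le_rfl, fun _ => zero_le_one⟩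

lemma DetAlg.values_of_node_eq (A : DetAlg d X) (t : ℕ → cube d) (h : ∀ i v, A.node i v = t i)
    (f : (Fin d → ℝ) → X) (n : ℕ) : A.values f n = fun j : Fin n => f (t j) := by
  induction n with
  | zero => exact Subsingleton.elim _ _
  | succ n ih =>
    ext j
    simp only [DetAlg.values, ih, h]
    refine Fin.lastCases ?_ (fun j => ?_) j <;> simp

/-- Nonadaptive algorithms: any function of the values at finitely many fixed nodes. -/
lemma exists_nonadaptive [Zero X] {I : Type} [Fintype I] (τ : I → cube d) (out : (I → X) → X) :
    ∃ A : DetAlg d X, ∀ f : (Fin d → ℝ) → X,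
      A.card f = (Fintype.card I : ℕ) ∧ A.result f = out (fun i => f (τ i)) := by
  classical
  set N := Fintype.card I with hN
  let e : I ≃ Fin N := Fintype.equivFin I
  let t : ℕ → cube d := fun i => if h : i < N then τ (e.symm ⟨i, h⟩) else ⟨0, zero_mem_cube d⟩
  let A : DetAlg d X :=
    { node := fun i _ => t i
      halt := fun i _ => decide (i = N)
      output := fun i v => if h : i = N then out fun a => v (Fin.cast h.symm (e a)) else 0 }
  refine ⟨A, fun f => ?_⟩
  have hc : A.card f = (N : ℕ) := by
    rw [DetAlg.card_eq_coe_iff]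
    refine ⟨by simp [A], fun k hk => ?_⟩
    simp [A, hk.ne]
  refine ⟨hc, ?_⟩
  rw [A.result_eq_of_card_eq f hc, A.values_of_node_eq t fun _ _ => rfl]
  simp [A, t]

end Nonadaptive

section CubeMeasure

/-- The uniform distribution on the cube. -/
noncomputable def cubeMeasure (d : ℕ) : Measure (cube d) :=
  (volume : Measure (Fin d → ℝ)).comap Subtype.val

lemma volume_cube (d : ℕ) : volume (cube d) = 1 := by
  rw [cube, Real.volume_Icc_pi]
  simp

instance (d : ℕ) : IsProbabilityMeasure (cubeMeasure d) := by
  refine ⟨?_⟩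
  rw [cubeMeasure, comap_subtype_coe_apply (measurableSet_cube d)]
  simp [volume_cube]

variable {d : ℕ} {X : Type u} [NormedAddCommGroup X] [NormedSpace ℝ X]

lemma integral_cubeMeasure (f : (Fin d → ℝ) → X) : ∫ t, f t ∂cubeMeasure d = integralOp f :=
  integral_subtype_comap (measurableSet_cube d) f

lemma norm_integralOp_le {r : ℕ} {f : (Fin d → ℝ) → X} (hf : f ∈ crBall d X r) :
    ‖integralOp f‖ ≤ 1 := by
  rw [← integral_cubeMeasure]
  refine (norm_integral_le_of_norm_le_const (C := 1) (Filter.Eventually.of_forall fun t =>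
    norm_le_one_of_mem_crBall hf t.2)).trans (by simp)

end CubeMeasure

section Algorithm

variable {d r : ℕ} {X : Type u} [NormedAddCommGroup X] [NormedSpace ℝ X]

lemma continuous_of_mem_crBall {f : (Fin d → ℝ) → X} (hf : f ∈ crBall d X r) :
    Continuous fun t : cube d => f t :=
  continuousOn_iff_continuous_domRestrict.1 hf.1.continuousOn

/-- A randomized algorithm bounds the minimal error if it uses a fixed number of values and its
output depends on the random parameter in a strongly measurable way. The random parameter is
lifted to the required universe. -/
lemma ranMinError_le_of_stronglyMeasurable {Ω₀ : Type} [MeasurableSpace Ω₀] (ρ : Measure Ω₀)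
    [IsProbabilityMeasure ρ] (A : Ω₀ → DetAlg d X) {N n : ℕ} (hN : N ≤ n)
    (hcard : ∀ ω f, (A ω).card f = N)
    (hmeas : ∀ f ∈ crBall d X r, StronglyMeasurable fun ω => (A ω).result f) {b : ℝ≥0∞}
    (hb : ∀ f ∈ crBall d X r, ∫⁻ ω, ‖integralOp f - (A ω).result f‖ₑ ∂ρ ≤ b) :
    ranMinError.{u, v} d X r n ≤ b := by
  let P : Measure (ULift.{v} Ω₀) := ρ.map MeasurableEquiv.ulift.symm
  have hP : IsProbabilityMeasure P :=
    Measure.isProbabilityMeasure_map MeasurableEquiv.ulift.symm.measurable.aemeasurable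
  have hA : IsRandAlg r n P fun ω => A ω.down := by
    refine ⟨hP, fun f _ => ?_, fun f _ => ?_, fun f hf => ?_, fun f hf => ?_⟩
    · simp only [hcard]
      exact measurable_const
    · simp only [hcard, lintegral_const, measure_univ, mul_one]
      simpa using hN
    · let _ : MeasurableSpace X := borel X
      have _ : BorelSpace X := ⟨rfl⟩
      exact (hmeas f hf).measurable.comp measurable_down
    · refine ⟨Submodule.span ℝ (Set.range fun ω => (A ω).result f),
        (hmeas f hf).isSeparable_range.span, Filter.Eventually.of_forall fun ω => ?_⟩
      exact Submodule.subset_span ⟨ω.down, rfl⟩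
  have hle : ranMinError.{u, v} d X r n ≤ randError r P fun ω => A ω.down := by
    unfold ranMinError
    exact iInf_le_of_le (ULift.{v} Ω₀) (iInf_le_of_le _ (iInf_le_of_le P
      (iInf_le_of_le (fun ω => A ω.down) (iInf_le _ hA))))
  refine hle.trans ?_
  refine iSup₂_le fun f hf => ?_
  rw [lintegral_map_equiv]
  exact hb f hf

/-- Without any function values the error is at most `1`. -/
lemma ranMinError_le_one (n : ℕ) : ranMinError.{u, v} d X r n ≤ 1 := by
  obtain ⟨A, hA⟩ := exists_nonadaptive (d := d) (X := X) (I := Empty) Empty.elim fun _ => 0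
  refine ranMinError_le_of_stronglyMeasurable (Measure.dirac ()) (fun _ => A) (N := 0)
    (Nat.zero_le n) (fun _ f => by simpa using (hA f).1) (fun f _ => stronglyMeasurable_const)
    fun f hf => ?_
  rw [(hA f).2]
  simp only [sub_zero, lintegral_const, measure_univ, mul_one]
  rw [← ofReal_norm, ENNReal.ofReal_le_one]
  exact norm_integralOp_le hf

variable [CompleteSpace X]

/-- Variance reduction: the integral of the interpolant is computed exactly, and the Monte Carlo
method is applied to the interpolation error only. -/
lemma ranMinError_le_of_interpolation {κ : Type} [Fintype κ] {y : κ → cube d}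
    {W : κ → cube d → ℝ} (hW : ∀ j, Measurable (W j)) {D : ℝ} (hD : ∀ j t, |W j t| ≤ D) {δ : ℝ}
    (hδ : ∀ f ∈ crBall d X r, ∀ t : cube d, ‖f t - ∑ j, W j t • f (y j)‖ ≤ δ)
    {m n : ℕ} (hm : 1 ≤ m) (hn : Fintype.card κ + m ≤ n) {B : ℝ}
    (hB : ∀ x : Fin m → X, (∀ i, ‖x i‖ ≤ δ) → radMean x ≤ B) :
    ranMinError.{u, v} d X r n ≤ ENNReal.ofReal ((m : ℝ)⁻¹ * (2 * B)) := by
  set μ := cubeMeasure d with hμ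
  have hm0 : (m : ℝ) ≠ 0 := by exact_mod_cast (by omega : m ≠ 0)
  have hex := fun ω : Fin m → cube d => exists_nonadaptive (d := d) (X := X) (I := κ ⊕ Fin m)
    (Sum.elim y ω) fun v => ∑ j, (∫ t, W j t ∂μ) • v (Sum.inl j) +
      (m : ℝ)⁻¹ • ∑ i, (v (Sum.inr i) - ∑ j, W j (ω i) • v (Sum.inl j))
  choose A hA using hex
  have hres : ∀ (f : (Fin d → ℝ) → X) ω, (A ω).result f = ∑ j, (∫ t, W j t ∂μ) • f (y j) +
      (m : ℝ)⁻¹ • ∑ i, (f (ω i) - ∑ j, W j (ω i) • f (y j)) := fun f ω => (hA ω f).2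
  have hgm : ∀ f ∈ crBall d X r, StronglyMeasurable fun t : cube d =>
      f t - ∑ j, W j t • f (y j) := by
    intro f hf
    exact (continuous_of_mem_crBall hf).stronglyMeasurable.sub
      (Finset.stronglyMeasurable_fun_sum _ fun j _ => (hW j).stronglyMeasurable.smul_const _)
  have hWi : ∀ j, Integrable (W j) μ := fun j =>
    Integrable.of_bound (hW j).aestronglyMeasurable D (Filter.Eventually.of_forall (hD j))
  have hsm : ∀ f ∈ crBall d X r, StronglyMeasurable fun ω : Fin m → cube d =>
      ∑ i, (f (ω i) - ∑ j, W j (ω i) • f (y j)) := fun f hf =>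
    Finset.stronglyMeasurable_fun_sum _ fun i _ =>
      (hgm f hf).comp_measurable (measurable_pi_apply i)
  refine ranMinError_le_of_stronglyMeasurable (Measure.pi fun _ : Fin m => μ) A
    (N := Fintype.card κ + m) hn (fun ω f => by simpa using (hA ω f).1) (fun f hf => ?_)
    fun f hf => ?_
  · simp only [hres]
    exact stronglyMeasurable_const.add ((hsm f hf).const_smul _)
  · set g : cube d → X := fun t => f t - ∑ j, W j t • f (y j) with hg
    have hfi : Integrable (fun t : cube d => f t) μ :=
      Integrable.of_bound (continuous_of_mem_crBall hf).aestronglyMeasurable 1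
        (Filter.Eventually.of_forall fun t => norm_le_one_of_mem_crBall hf t.2)
    have hint : ∫ t, g t ∂μ = integralOp f - ∑ j, (∫ t, W j t ∂μ) • f (y j) := by
      rw [hg, integral_sub hfi (integrable_finsetSum _ fun j _ => (hWi j).smul_const _),
        integral_cubeMeasure, integral_finsetSum _ fun j _ => (hWi j).smul_const _]
      simp only [integral_smul_const]
    have herr : ∀ ω, integralOp f - (A ω).result f =
        -((m : ℝ)⁻¹ • (∑ i, g (ω i) - (m : ℝ) • ∫ t, g t ∂μ)) := by
      intro ω
      rw [hres, smul_sub, smul_smul, inv_mul_cancel₀ hm0, one_smul, hint]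
      abel
    have hMC := integral_norm_sum_sub_le (μ := μ) (hgm f hf) (hδ f hf) hB
    have hi : Integrable (fun ω : Fin m → cube d => ∑ i, g (ω i) - (m : ℝ) • ∫ t, g t ∂μ)
        (Measure.pi fun _ => μ) := by
      refine Integrable.sub (Integrable.of_bound (hsm f hf).aestronglyMeasurable
        (∑ _i : Fin m, δ) (Filter.Eventually.of_forall fun ω => ?_)) (integrable_const _)
      exact (norm_sum_le _ _).trans (Finset.sum_le_sum fun i _ => hδ f hf _)
    have hpt : ∀ ω, ‖integralOp f - (A ω).result f‖ₑ =
        ENNReal.ofReal (m : ℝ)⁻¹ * ‖∑ i, g (ω i) - (m : ℝ) • ∫ t, g t ∂μ‖ₑ := by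
      intro ω
      rw [herr, enorm_neg, enorm_smul, Real.enorm_of_nonneg (by positivity)]
    simp only [hpt]
    rw [lintegral_const_mul' _ _ ENNReal.ofReal_ne_top,
      ← ofReal_integral_norm_eq_lintegral_enorm hi, ← ENNReal.ofReal_mul (by positivity)]
    exact ENNReal.ofReal_le_ofReal (mul_le_mul_of_nonneg_left hMC (by positivity))

end Algorithm

/-! ### The rate of the minimal errors -/

section Rate

variable {X : Type u} [NormedAddCommGroup X] [NormedSpace ℝ X] [CompleteSpace X]

/-- A number `k` of subdivisions such that a multiple of `k ^ d` stays below `n`, but is not much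
smaller than `n`. -/
lemma exists_pow_le {d : ℕ} (hd : 1 ≤ d) {x : ℝ} (hx : 1 ≤ x) :
    ∃ k : ℕ, 1 ≤ k ∧ (k : ℝ) ^ d ≤ x ∧ 1 / 2 * x ^ (1 / (d : ℝ)) ≤ k := by
  have hd0 : (0 : ℝ) < d := by exact_mod_cast hd
  set s : ℝ := x ^ (1 / (d : ℝ)) with hs
  have hs1 : 1 ≤ s := Real.one_le_rpow hx (by positivity)
  have hk : 1 ≤ ⌊s⌋₊ := Nat.le_floor (by simpa using hs1)
  refine ⟨⌊s⌋₊, hk, ?_, ?_⟩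
  · have h1 : x = s ^ d := by
      rw [hs, ← Real.rpow_natCast, ← Real.rpow_mul (by linarith), one_div_mul_cancel hd0.ne',
        Real.rpow_one]
    rw [h1]
    exact pow_le_pow_left₀ (by positivity) (Nat.floor_le (by linarith)) d
  · have h1 := Nat.lt_floor_add_one s
    have h2 : (1 : ℝ) ≤ (⌊s⌋₊ : ℕ) := by exact_mod_cast hk
    linarith

theorem IsEqualNormType.ranMinError_le {d r : ℕ} (hd : 1 ≤ d) {p : ℝ} (hp1 : 1 ≤ p)
    (h : IsEqualNormType X p) : ∃ c : ℝ, 0 < c ∧ ∀ n : ℕ, 1 ≤ n → ranMinError.{u, v} d X r n ≤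
      ENNReal.ofReal (c * (n : ℝ) ^ (-(r : ℝ) / (d : ℝ) - 1 + 1 / p)) := by
  have hp0 : 0 < p := by linarith
  have hd0 : (0 : ℝ) < d := by exact_mod_cast hd
  obtain ⟨c, hc, hR⟩ := h.radMean_le hp1
  obtain ⟨C, hC, hint⟩ := exists_interpolation_cube d r X
  set e : ℝ := -(r : ℝ) / (d : ℝ) - 1 + 1 / p with he
  have he0 : e ≤ 0 := by
    have h1 : 1 / p ≤ 1 := by rw [div_le_one hp0]; exact hp1
    have h2 : -(r : ℝ) / (d : ℝ) ≤ 0 := by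
      rw [neg_div]; exact neg_nonpos.2 (by positivity)
    linarith
  -- The number of function values is `M` times the number of subcubes.
  set M : ℝ := (r : ℝ) ^ d + 1 with hM
  have hM1 : 1 ≤ M := le_add_of_nonneg_left (by positivity)
  have hM0 : 0 < M := by linarith
  set c' : ℝ := M⁻¹ ^ e * (1 + 2 * c * C * (1 / 2 : ℝ) ^ (d * e)) with hc'
  refine ⟨c', by positivity, fun n hn => ?_⟩
  have hn0 : (0 : ℝ) < n := by exact_mod_cast hn
  have hnM : M⁻¹ ^ e * (n : ℝ) ^ e = ((n : ℝ) / M) ^ e := by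
    rw [← Real.mul_rpow (by positivity) hn0.le, div_eq_inv_mul]
  have hsplit : c' * (n : ℝ) ^ e =
      ((n : ℝ) / M) ^ e + 2 * c * C * ((1 / 2 : ℝ) ^ (d * e) * ((n : ℝ) / M) ^ e) := by
    rw [← hnM, hc']; ring
  have hpos1 : 0 ≤ ((n : ℝ) / M) ^ e := by positivity
  have hpos2 : 0 ≤ 2 * c * C * ((1 / 2 : ℝ) ^ (d * e) * ((n : ℝ) / M) ^ e) := by positivity
  rcases lt_or_ge (n : ℝ) M with hlt | hge
  · refine (ranMinError_le_one n).trans ?_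
    rw [← ENNReal.ofReal_one]
    refine ENNReal.ofReal_le_ofReal ?_
    have h1 : 1 ≤ ((n : ℝ) / M) ^ e :=
      Real.one_le_rpow_of_pos_of_le_one_of_nonpos (by positivity)
        ((div_le_one hM0).2 hlt.le) he0
    linarith
  · obtain ⟨k, hk, hkd, hks⟩ := exists_pow_le hd ((one_le_div hM0).2 hge)
    have hk0 : (0 : ℝ) < k := by exact_mod_cast hk
    obtain ⟨y, W, hW, ⟨D, hD⟩, hδ⟩ := hint k hk
    set δ : ℝ := C * ((k : ℝ) ^ r)⁻¹ with hδdef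
    have hδ0 : 0 < δ := by positivity
    have hcount : Fintype.card (Fin d → Fin k × Fin r) + k ^ d ≤ n := by
      rw [le_div_iff₀ hM0, hM] at hkd
      have h1 : ((Fintype.card (Fin d → Fin k × Fin r) + k ^ d : ℕ) : ℝ) ≤ n := by
        simp only [Fintype.card_pi, Fintype.card_prod, Fintype.card_fin, Finset.prod_const,
          Finset.card_univ]
        push_cast
        rw [mul_pow]
        linarith
      exact_mod_cast h1
    have hB : ∀ x : Fin (k ^ d) → X, (∀ i, ‖x i‖ ≤ δ) →
        radMean x ≤ δ * (c * ((k ^ d : ℕ) : ℝ) ^ (1 / p)) := by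
      intro x hx
      have h1 : x = fun i => δ • (δ⁻¹ • x i) := by
        ext i; rw [smul_smul, mul_inv_cancel₀ hδ0.ne', one_smul]
      rw [h1, radMean_smul, abs_of_pos hδ0]
      refine mul_le_mul_of_nonneg_left (hR _ _ fun i => ?_) hδ0.le
      rw [norm_smul, norm_inv, Real.norm_of_nonneg hδ0.le, inv_mul_le_iff₀ hδ0, mul_one]
      exact hx i
    refine (ranMinError_le_of_interpolation hW hD hδ (Nat.one_le_pow _ _ hk) hcount hB).trans ?_
    refine ENNReal.ofReal_le_ofReal ?_
    have hpow : (((k ^ d : ℕ) : ℝ))⁻¹ * (2 * (δ * (c * ((k ^ d : ℕ) : ℝ) ^ (1 / p)))) =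
        2 * c * C * (k : ℝ) ^ (d * e) := by
      have h1 : ((k ^ d : ℕ) : ℝ) = (k : ℝ) ^ (d : ℝ) := by
        rw [Real.rpow_natCast]; push_cast; rfl
      have h2 : d * e = -(r : ℝ) + -(d : ℝ) + d * (1 / p) := by
        rw [he]; field_simp; ring
      rw [h1, hδdef, h2, Real.rpow_add hk0, Real.rpow_add hk0, Real.rpow_neg hk0.le,
        Real.rpow_neg hk0.le, Real.rpow_natCast, Real.rpow_natCast, Real.rpow_mul hk0.le,
        Real.rpow_natCast]
      ring
    have hke : (k : ℝ) ^ (d * e) ≤ (1 / 2 : ℝ) ^ (d * e) * ((n : ℝ) / M) ^ e := by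
      have h1 : ((n : ℝ) / M) ^ e = (((n : ℝ) / M) ^ (1 / (d : ℝ))) ^ (d * e) := by
        rw [← Real.rpow_mul (by positivity), ← mul_assoc, one_div_mul_cancel hd0.ne', one_mul]
      rw [h1, ← Real.mul_rpow (by norm_num) (by positivity)]
      exact Real.rpow_le_rpow_of_nonpos (by positivity) hks
        (mul_nonpos_of_nonneg_of_nonpos hd0.le he0)
    rw [hpow, hsplit]
    have h3 : 2 * c * C * (k : ℝ) ^ (d * e) ≤
        2 * c * C * ((1 / 2 : ℝ) ^ (d * e) * ((n : ℝ) / M) ^ e) :=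
      mul_le_mul_of_nonneg_left hke (by positivity)
    linarith

end Rate

end BanachIntegration

theorem corollary2 (d : ℕ) (hd : 1 ≤ d) (r : ℕ) (p : ℝ) (hp1 : 1 ≤ p) (hp2 : p ≤ 2)
    (X : Type u) [NormedAddCommGroup X] [NormedSpace ℝ X] [CompleteSpace X] :
    BanachIntegration.IsEqualNormType X p ↔
      ∃ c : ℝ, 0 < c ∧ ∀ n : ℕ, 1 ≤ n →
        BanachIntegration.ranMinError.{u, v} d X r n ≤
          ENNReal.ofReal (c * (n : ℝ) ^ (-(r : ℝ) / (d : ℝ) - 1 + 1 / p)) := by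
  refine ⟨fun h => h.ranMinError_le hd hp1, ?_⟩
  rintro ⟨c, hc, h⟩
  exact BanachIntegration.isEqualNormType_of_ranMinError_le.{u, v} hd hp1 hp2 hc h
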